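/- Let $\mathbb{M}^{10,1}$ be eleven-dimensional Minkowski space with orthonormal frame $e_0,e_1,\dots,e_9,e_\natural$ and quadratic form $Q(x)=-x_0^2+x_1^2+\dots+x_9^2+x_\natural^2$. Let $\mathrm{C}\ell$ be its real Clifford algebra ($x\cdot x=Q(x)$), with generators $\Gamma_M$ corresponding to $e_M$ and $\Gamma_{MN}=\Gamma_M\Gamma_N$ for $M\neq N$, and let $\Delta$ be an irreducible real $\mathrm{C}\ell$-module. Multivectors act on $\Delta$ through the canonical linear isomorphism $\bigwedge\mathbb{M}^{10,1}\cong\mathrm{C}\ell$. For multivectors $\pi_1,\pi_2$ put $\Delta(\pi_1)=\{\varepsilon\in\Delta:\pi_1\cdot\varepsilon=\varepsilon\}$ and $\Delta(\pi_1\cup\pi_2)=\Delta(\pi_1)\cap\Delta(\pi_2)$; the configuration is supersymmetric if $\Delta(\pi_1\cup\pi_2)\neq 0$, and its fraction $\nu$ is defined by $32\,\nu=\dim\Delta(\pi_1\cup\pi_2)$. Let $\pi=e_0\wedge e_1\wedge e_3\wedge e_5\wedge e_7\wedge e_9$ and $\xi=\langle e_1,e_3,e_5,e_7,e_9\rangle$.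 For $\theta\in\mathbb{R}^4$ and $\alpha,\beta\in\mathbb{R}$ let $L=R(\theta)\,S(v)$, where $R=R(\theta)\in\mathrm{SO}_8$ is the product of the rotations by the angles $\theta_1,\theta_2,\theta_3,\theta_4$ in the planes $(e_1,e_2)$, $(e_3,e_4)$, $(e_5,e_6)$, $(e_7,e_8)$, and $S(v)=\exp(\alpha\Sigma_{0\natural}+\beta\Sigma_{9\natural})$ with $v=\alpha e_0+\beta e_9$; here $\Sigma_{MN}$ is the infinitesimal Lorentz transformation $x\mapsto[\tfrac12\Gamma_{MN},x]$, and the rotations are taken in the sense of $\exp(\theta_1\Sigma_{12})$, etc. Put $\widehat R=\exp\big(\tfrac12(\theta_1\Gamma_{12}+\theta_2\Gamma_{34}+\theta_3\Gamma_{56}+\theta_4\Gamma_{78})\big)$ and $\widehat N=\alpha\Gamma_{0\natural}+\beta\Gamma_{9\natural}$. Let $d$ be the codimension of $\xi\cap R\xi$ in $\xi$. Then: 1. $\dim\Delta=32$; $\widehat R$ lies in the spin group and is a lift of $R$; and if $\alpha^2=\beta^2$, then $1+\tfrac12\widehat N$ lies in the spin group and is a lift of $S(v)$. 2. (Boosts.)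 If $\alpha^2>\beta^2$, the configuration $\pi\cup L\pi$ is not supersymmetric. 3. (Static branes.) $\varepsilon\in\Delta(\pi\cup R\pi)$ if and only if $\pi\cdot\varepsilon=\varepsilon$ and $\widehat R^2\cdot\varepsilon=\varepsilon$. 4. (Null rotations.) If $\alpha^2=\beta^2$, then $\varepsilon\in\Delta(\pi\cup L\pi)$ if and only if $\pi\cdot\varepsilon=\varepsilon$, $\widehat R^2\cdot\varepsilon=\varepsilon$ and $\widehat N\cdot\varepsilon=0$. 5. Let $\alpha^2=\beta^2\neq0$. Then $\dim\Delta(\pi\cup L\pi)=\tfrac12\dim\Delta(\pi\cup R\pi)$ for all $\theta$. The pairs $(d,\nu)$ that occur for supersymmetric $\pi\cup L\pi$, as $\theta$ varies, are exactly $(4,\tfrac1{32})$, $(4,\tfrac1{16})$, $(4,\tfrac3{32})$, $(4,\tfrac18)$, $(3,\tfrac1{16})$, $(2,\tfrac18)$ and $(0,\tfrac14)$. In codimension $4$ the fractions arise by progressive specialisation $\tfrac1{32}\to\tfrac1{16}\to\tfrac3{32}\to\tfrac18$: for $k=1,2,3$, the set of $\theta$ with $d=4$ and $\nu=\tfrac{k+1}{32}$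 lies in the closure of the set of $\theta$ with $d=4$ and $\nu=\tfrac{k}{32}$. -/

import Mathlib

noncomputable section

namespace M5

/-- Eleven-dimensional Minkowski space; the coordinates `0, 1, …, 9` are the usual ones and `10` is
the last spatial direction `♮`. -/
abbrev Mink : Type := Fin 11 → ℝ

/-- The diagonal of the Minkowski metric, `(-1, 1, …, 1)`. -/
def eta (i : Fin 11) : ℝ := if i = 0 then -1 else 1

/-- The Minkowski quadratic form `-x₀² + x₁² + ⋯ + x₉² + x♮²`. -/
def minkQ : QuadraticForm ℝ Mink := QuadraticMap.weightedSumSquares ℝ eta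

/-- The Clifford algebra, with `x · x = Q(x)`, so that `Γ₀² = -1` and `Γᵢ² = 1` for `i ≠ 0`. -/
abbrev Cl : Type := CliffordAlgebra minkQ

/-- The frame vector `e_i`. -/
def e (i : Fin 11) : Mink := Pi.single i 1

/-- The generator `Γ_i` of the Clifford algebra. -/
def Gam (i : Fin 11) : Cl := CliffordAlgebra.ι minkQ (e i)

/-- The isomorphism of vector spaces `⋀ 𝕄 ≅ Cl`. -/
def quantize : ExteriorAlgebra ℝ Mink ≃ₗ[ℝ] Cl := (CliffordAlgebra.equivExterior minkQ).symm

/-- The multivector `π = e₀ ∧ e₁ ∧ e₃ ∧ e₅ ∧ e₇ ∧ e₉` of the tangent plane of the first brane. -/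
def brane : ExteriorAlgebra ℝ Mink := ExteriorAlgebra.ιMulti ℝ 6 ![e 0, e 1, e 3, e 5, e 7, e 9]

/-- The image of a multivector under a linear transformation of Minkowski space. -/
def transform (A : Matrix (Fin 11) (Fin 11) ℝ) (p : ExteriorAlgebra ℝ Mink) :
    ExteriorAlgebra ℝ Mink :=
  ExteriorAlgebra.map (Matrix.toLin' A) p

/-- The rotation `R_{jk}(t)` in the plane of `e_j` and `e_k` (for distinct `j`, `k`), with block
`(cos t, sin t; -sin t, cos t)`; the sense of rotation is the one of conjugation by
`exp (t/2 Γ_j Γ_k)`. -/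
def planeRot (j k : Fin 11) (t : ℝ) : Matrix (Fin 11) (Fin 11) ℝ :=
  1 + (Real.cos t - 1) • (Matrix.single j j 1 + Matrix.single k k 1)
    + Real.sin t • (Matrix.single j k 1 - Matrix.single k j 1)

/-- The element `R(θ)` of the maximal torus of `SO₈`. -/
def torusRot (θ : Fin 4 → ℝ) : Matrix (Fin 11) (Fin 11) ℝ :=
  planeRot 1 2 (θ 0) * planeRot 3 4 (θ 1) * planeRot 5 6 (θ 2) * planeRot 7 8 (θ 3)

/-- The Lorentz generator `Σ_{MN} : e_P ↦ η_{NP} e_M - η_{MP} e_N`, which is the commutator with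
`½ Γ_M Γ_N`. -/
def lorentzGen (M N : Fin 11) : Matrix (Fin 11) (Fin 11) ℝ :=
  eta N • Matrix.single M N 1 - eta M • Matrix.single N M 1

/-- `S(v) = exp (α Σ_{0♮} + β Σ_{9♮})`, where `v = α e₀ + β e₉`. -/
def lorentzS (α β : ℝ) : Matrix (Fin 11) (Fin 11) ℝ :=
  NormedSpace.exp (α • lorentzGen 0 10 + β • lorentzGen 9 10)

/-- The normal form `L = R(θ) S(v)`. -/
def lorentzL (θ : Fin 4 → ℝ) (α β : ℝ) : Matrix (Fin 11) (Fin 11) ℝ :=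
  torusRot θ * lorentzS α β

/-- `exp (t/2 Γ_j Γ_k)`, for distinct spatial directions `j`, `k`, where `(Γ_j Γ_k)² = -1`. -/
def halfRot (j k : Fin 11) (t : ℝ) : Cl :=
  algebraMap ℝ Cl (Real.cos (t / 2)) + Real.sin (t / 2) • (Gam j * Gam k)

/-- The lift `R̂ = exp (½ θ₁ Γ₁₂ + ½ θ₂ Γ₃₄ + ½ θ₃ Γ₅₆ + ½ θ₄ Γ₇₈)` of `R(θ)`. -/
def Rhat (θ : Fin 4 → ℝ) : Cl :=
  halfRot 1 2 (θ 0) * halfRot 3 4 (θ 1) * halfRot 5 6 (θ 2) * halfRot 7 8 (θ 3)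

/-- `N̂ = α Γ_{0♮} + β Γ_{9♮}`. -/
def Nhat (α β : ℝ) : Cl := α • (Gam 0 * Gam 10) + β • (Gam 9 * Gam 10)

/-- `g` belongs to the spin group and covers the linear transformation `A`:
`g x g⁻¹ = A x` for all vectors `x`. -/
def IsSpinLift (g : Cl) (A : Matrix (Fin 11) (Fin 11) ℝ) : Prop :=
  g ∈ spinGroup minkQ ∧
    ∀ x : Mink, g * CliffordAlgebra.ι minkQ x = CliffordAlgebra.ι minkQ (A.mulVec x) * g

section Spinors

variable (Δ : Type*) [AddCommGroup Δ] [Module ℝ Δ] [Module Cl Δ] [IsScalarTower ℝ Cl Δ]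

/-- `Δ(p)`, the space of the spinors `ε` with `p · ε = ε`. -/
def susySpace (p : ExteriorAlgebra ℝ Mink) : Submodule ℝ Δ :=
  LinearMap.eqLocus (Algebra.lsmul ℝ ℝ Δ (quantize p)) LinearMap.id

/-- `Δ(p ∪ q) = Δ(p) ∩ Δ(q)`. -/
def susySpace₂ (p q : ExteriorAlgebra ℝ Mink) : Submodule ℝ Δ :=
  susySpace Δ p ⊓ susySpace Δ q

/-- The configuration of two branes with tangent planes `p`, `q` is supersymmetric. -/
def IsSupersymmetric (p q : ExteriorAlgebra ℝ Mink) : Prop := susySpace₂ Δ p q ≠ ⊥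

/-- The fraction `ν` of supersymmetry which is preserved, `32 ν = dim Δ(p ∪ q)`. -/
def fraction (p q : ExteriorAlgebra ℝ Mink) : ℚ := (Module.finrank ℝ (susySpace₂ Δ p q) : ℚ) / 32

end Spinors

/-- The spatial plane `ξ = ⟨e₁, e₃, e₅, e₇, e₉⟩` of the first brane, `π = e₀ ∧ ξ`. -/
def spatialPlane : Submodule ℝ Mink := Submodule.span ℝ {e 1, e 3, e 5, e 7, e 9}

/-- The codimension of the spatial intersection `ξ ∩ R(θ) ξ` in `ξ`. -/
def codim (θ : Fin 4 → ℝ) : ℕ :=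
  Module.finrank ℝ spatialPlane -
    Module.finrank ℝ ↥(spatialPlane ⊓ spatialPlane.map (Matrix.toLin' (torusRot θ)))

/-- The pairs (codimension, fraction) of null-rotated branes. -/
def nullTable : Set (ℕ × ℚ) :=
  {(4, 1 / 32), (4, 1 / 16), (4, 3 / 32), (4, 1 / 8), (3, 1 / 16), (2, 1 / 8), (0, 1 / 4)}

end M5

end

noncomputable section

namespace M5

open CliffordAlgebra

/-! ### Minkowski space and its Clifford algebra -/

/-! Write `π` also for the Clifford element of the brane. If `g` lifts `L`, the element of the
transformed brane is `g π g⁻¹`. Each of the bivectors `Γ₁₂, Γ₃₄, Γ₅₆, Γ₇₈, Γ₀♮, Γ₉♮` has exactly one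
index in the brane and so anticommutes with `π`. Hence `π g⁻¹ = g π`, the transformed brane is `g²
π`, and on `Δ(π)` the second condition becomes `g² ε = ε` (`mem_susySpace₂_iff`). Here `g` is `R̂`
times a commuting lift of `S(v)`.

The commuting involutions `Γ₁₂₃₄, Γ₁₂₅₆, Γ₁₂₇₈` split `Δ` into eight sectors, labelled by signs `s`.
On a sector `R̂²` is `cos φ + sin φ Γ₁₂` with `φ = θ₁ ± θ₂ ± θ₃ ± θ₄`
(`Rhat_sq_smul_of_mem_sector`). As `Γ₁₂² = -1`, its only possible real eigenvalues are `±1`. For a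
boost the other factor of `g²` has eigenvalues `exp (±r)` with `r ≠ 0`, which `R̂²` cannot
compensate. For a null rotation that factor is `1 + N̂` with `N̂² = 0`, and the fixed-point equation
separates into `R̂² ε = ε` and `N̂ ε = 0`.

The dimension is bounded above by moving a joint eigenline of six commuting monomials with five
others, and is divisible by 32 because five commuting involutions halve it in turn. Thus each sector
meets `Δ(π)` and either eigenspace of `Γ₀₉` in a line. For nonzero null `v`, `ker N̂` is an
eigenspace of `Γ₀₉`, so `32 ν` is the number of sectors with `φ ∈ 2πℤ` (`finrank_null`), while `d`
is the number of angles outside `πℤ` (`codim_eq`).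

The rest is counting. From one fixed sector, flipping signs changes `φ` by twice a partial sum of
signed angles, so `d` and `ν` depend only on which partial sums lie in `πℤ`; finitely many patterns
are possible (`codim_card_mem`). If `d = 4`, distinct fixed sectors have orthogonal sign vectors,
and moving `θ` along one of these vectors destroys exactly that sector (`mem_closure_card`). -/

theorem minkQ_apply (x : Mink) : minkQ x = ∑ i, eta i * (x i * x i) := by
  simp [minkQ, QuadraticMap.weightedSumSquares_apply]

theorem polar_e (x : Mink) (i : Fin 11) :
    QuadraticMap.polar minkQ x (e i) = 2 * (eta i * x i) := by
  have h : ∀ k, eta k * ((x + e i) k * (x + e i) k) - eta k * (x k * x k)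
      - eta k * (e i k * e i k) = Pi.single (M := fun _ => ℝ) i (2 * (eta i * x i)) k := by
    intro k
    by_cases hk : k = i
    · subst hk; simp [e]; ring
    · simp [e, hk]
  rw [QuadraticMap.polar, minkQ_apply, minkQ_apply, minkQ_apply, ← Finset.sum_sub_distrib,
    ← Finset.sum_sub_distrib, Finset.sum_congr rfl fun k _ => h k]
  simp

theorem minkQ_e (i : Fin 11) : minkQ (e i) = eta i := by
  rw [minkQ_apply, Finset.sum_eq_single i]
  · simp [e]
  · intro k _ hk; simp [e, hk]
  · simp

/-- The isomorphism with the exterior algebra carries `ι` to the exterior `ι`, which has a left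
inverse. Identities between matrices can therefore be checked inside the Clifford algebra. -/
theorem cl_iota_injective : Function.Injective (ι minkQ) := by
  intro x y h
  have h' := congrArg (equivExterior minkQ) h
  rw [equivExterior, changeFormEquiv_apply, changeForm_ι, changeFormEquiv_apply, changeForm_ι] at h'
  exact ExteriorAlgebra.ι_leftInverse.injective h'

theorem iota_mul_Gam (x : Mink) (i : Fin 11) :
    ι minkQ x * Gam i = (2 * (eta i * x i)) • (1 : Cl) - Gam i * ι minkQ x := by
  rw [Gam, ι_mul_ι_comm, polar_e, Algebra.algebraMap_eq_smul_one]

theorem Gam_sq (i : Fin 11) : Gam i * Gam i = algebraMap ℝ Cl (eta i) := by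
  rw [Gam, ι_sq_scalar, minkQ_e]

theorem Gam_anticomm {i j : Fin 11} (h : i ≠ j) : Gam i * Gam j = -(Gam j * Gam i) := by
  have := iota_mul_Gam (e i) j
  rw [show e i j = 0 by simp [e, h.symm]] at this
  simpa [Gam] using this

theorem lorentzGen_mulVec (M N : Fin 11) (x : Mink) :
    (lorentzGen M N).mulVec x = (eta N * x N) • e M - (eta M * x M) • e N := by
  rw [lorentzGen, Matrix.sub_mulVec, Matrix.smul_mulVec, Matrix.smul_mulVec,
    Matrix.single_mulVec, Matrix.single_mulVec, mul_smul, mul_smul]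
  congr 2 <;> · ext k; simp [e, Function.update, Pi.single_apply]

/-- The commutator with `Γ_M Γ_N` is twice the Lorentz generator. -/
theorem commutator_Gam_mul_Gam (M N : Fin 11) (x : Mink) :
    Gam M * Gam N * ι minkQ x - ι minkQ x * (Gam M * Gam N) =
      (2 : ℝ) • ι minkQ ((lorentzGen M N).mulVec x) := by
  have h1 : Gam N * ι minkQ x = (2 * (eta N * x N)) • (1 : Cl) - ι minkQ x * Gam N := by
    rw [iota_mul_Gam]; abel
  rw [← mul_assoc, iota_mul_Gam, mul_assoc, h1, lorentzGen_mulVec, map_sub, map_smul, map_smul]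
  change _ = (2 : ℝ) • ((eta N * x N) • Gam M - (eta M * x M) • Gam N)
  simp only [mul_sub, sub_mul, mul_smul_comm, smul_mul_assoc, mul_one, one_mul, mul_assoc,
    smul_sub, smul_smul]
  abel

/-! ### Exponentials of Lorentz generators

If the commutator with `a` is `2 A` on vectors, then `A` satisfies the cubic equation which the
square of `a` dictates, and conjugation by the exponential of `a / 2` is the exponential of `A`. -/

section Conjugation

variable {a : Cl} {A : Matrix (Fin 11) (Fin 11) ℝ}

/-- Expand the double commutator: `[a, [a, x]] = 2 c x - 2 a x a`, and it also equals `4 A² x`. -/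
theorem mul_iota_mul (ha : ∀ x, a * ι minkQ x - ι minkQ x * a = (2 : ℝ) • ι minkQ (A.mulVec x))
    {c : ℝ} (hc : a * a = algebraMap ℝ Cl c) (x : Mink) :
    a * ι minkQ x * a = c • ι minkQ x - (2 : ℝ) • ι minkQ (A.mulVec (A.mulVec x)) := by
  have h2 : (2 : ℝ) • ((2 : ℝ) • ι minkQ (A.mulVec (A.mulVec x))) =
      (2 : ℝ) • (c • ι minkQ x) - (2 : ℝ) • (a * ι minkQ x * a) := by
    rw [← ha, smul_sub, ← mul_smul_comm, ← smul_mul_assoc, ← ha]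
    have h3 : a * (a * ι minkQ x) = c • ι minkQ x := by
      rw [← mul_assoc, hc, ← Algebra.smul_def]
    have h4 : ι minkQ x * a * a = c • ι minkQ x := by
      rw [mul_assoc, hc, ← Algebra.commutes, ← Algebra.smul_def]
    rw [mul_sub, sub_mul, h3, h4, two_smul, two_smul, mul_assoc]
    abel
  rw [← smul_sub] at h2
  rw [smul_right_injective Cl (two_ne_zero' ℝ) h2]
  abel

/-- Sandwiching between two copies of `a` sends `a x - x a` to `-c (a x - x a)`. Comparison with
`mul_iota_mul` at `A x` gives the cubic equation. -/
theorem generator_cube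
    (ha : ∀ x, a * ι minkQ x - ι minkQ x * a = (2 : ℝ) • ι minkQ (A.mulVec x))
    {c : ℝ} (hc : a * a = algebraMap ℝ Cl c) : A ^ 3 = c • A := by
  apply Matrix.toLin'.injective
  refine LinearMap.ext fun x => cl_iota_injective ?_
  have h1 := mul_iota_mul ha hc (A.mulVec x)
  have h2 : (2 : ℝ) • (a * ι minkQ (A.mulVec x) * a) = -((2 : ℝ) • (c • ι minkQ (A.mulVec x))) := by
    have h3 : a * (a * ι minkQ x) * a = c • (ι minkQ x * a) := by
      rw [← mul_assoc, hc, ← Algebra.smul_def, smul_mul_assoc]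
    have h4 : a * (ι minkQ x * a) * a = c • (a * ι minkQ x) := by
      rw [mul_assoc, mul_assoc, hc, ← mul_assoc, ← Algebra.commutes, ← Algebra.smul_def]
    rw [← smul_mul_assoc, ← mul_smul_comm, ← ha, smul_comm, ← ha, mul_sub, sub_mul, h3, h4,
      ← smul_sub, ← smul_neg]
    abel_nf
  rw [h1, smul_sub] at h2
  have h5 : (4 : ℝ) • ι minkQ (A.mulVec (A.mulVec (A.mulVec x))) =
      (4 : ℝ) • (c • ι minkQ (A.mulVec x)) := by
    linear_combination (norm := module) (-1 : ℝ) • h2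
  have h6 := smul_right_injective Cl (four_ne_zero' ℝ) h5
  simp only [Matrix.toLin'_apply, map_smul, LinearMap.smul_apply, pow_succ, pow_zero, one_mul]
  rw [← h6, Matrix.mulVec_mulVec, Matrix.mulVec_mulVec, mul_assoc]

/-- Conjugation by `p + q a`, where `p² - q² a² = 1`. -/
theorem conj_iota (ha : ∀ x, a * ι minkQ x - ι minkQ x * a = (2 : ℝ) • ι minkQ (A.mulVec x))
    {c : ℝ} (hc : a * a = algebraMap ℝ Cl c) {p q : ℝ} (hpq : p ^ 2 - q ^ 2 * c = 1) (x : Mink) :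
    (algebraMap ℝ Cl p + q • a) * ι minkQ x =
      ι minkQ ((1 + (2 * p * q) • A + (2 * q ^ 2) • A ^ 2).mulVec x)
        * (algebraMap ℝ Cl p + q • a) := by
  have h1 := mul_iota_mul ha hc x
  have hinv : (algebraMap ℝ Cl p - q • a) * (algebraMap ℝ Cl p + q • a) = 1 := by
    have : (algebraMap ℝ Cl p - q • a) * (algebraMap ℝ Cl p + q • a)
        = (p ^ 2) • (1 : Cl) - (q ^ 2) • (a * a) := by
      simp only [Algebra.algebraMap_eq_smul_one, sub_mul, mul_add, smul_mul_assoc, mul_smul_comm,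
        one_mul, mul_one]
      module
    rw [this, hc, Algebra.algebraMap_eq_smul_one, smul_smul, ← sub_smul, hpq, one_smul]
  have h2 : (algebraMap ℝ Cl p + q • a) * ι minkQ x * (algebraMap ℝ Cl p - q • a) =
      ι minkQ ((1 + (2 * p * q) • A + (2 * q ^ 2) • A ^ 2).mulVec x) := by
    have h3 : (algebraMap ℝ Cl p + q • a) * ι minkQ x * (algebraMap ℝ Cl p - q • a) =
        (p ^ 2) • ι minkQ x + (p * q) • (a * ι minkQ x - ι minkQ x * a)
          - (q ^ 2) • (a * ι minkQ x * a) := by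
      simp only [Algebra.algebraMap_eq_smul_one, add_mul, mul_sub, smul_mul_assoc, mul_smul_comm,
        one_mul, mul_one, smul_sub]
      module
    rw [h3, ha, h1]
    simp only [Matrix.add_mulVec, Matrix.smul_mulVec, Matrix.one_mulVec, map_add, map_smul, pow_two,
      ← Matrix.mulVec_mulVec]
    simp only [smul_sub, smul_smul]
    have h4 : ι minkQ x = (p ^ 2 - q ^ 2 * c) • ι minkQ x := by rw [hpq, one_smul]
    conv_rhs => rw [h4]
    module
  rw [← h2, mul_assoc, hinv, mul_one]

end Conjugation

section MatrixExp

variable (A : Matrix (Fin 11) (Fin 11) ℝ)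

theorem exp_of_cube_eq_zero (h : A ^ 3 = 0) :
    NormedSpace.exp A = 1 + A + (1 / 2 : ℝ) • A ^ 2 := by
  rw [NormedSpace.exp_eq_tsum ℝ]
  change ∑' n : ℕ, ((n.factorial : ℝ)⁻¹) • A ^ n = _
  rw [tsum_eq_sum (s := Finset.range 3)]
  · simp [Finset.sum_range_succ]
  · intro n hn
    rw [Finset.mem_range, not_lt] at hn
    rw [← Nat.sub_add_cancel hn, pow_add, h, mul_zero, smul_zero]

theorem exp_of_cube_eq {r : ℝ} (hr : r ≠ 0) (h : A ^ 3 = r ^ 2 • A) :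
    NormedSpace.exp A = 1 + (Real.sinh r / r) • A + ((Real.cosh r - 1) / r ^ 2) • A ^ 2 := by
  -- The polynomial `t³ - r² t` has roots `r`, `-r`, `0`; the three coefficients are the spectral
  -- projections. The convention `0 ^ 0 = 1` makes the last term contribute for `n = 0` only.
  have hpow : ∀ n : ℕ, A ^ n = r ^ n • ((1 / (2 * r ^ 2)) • A ^ 2 + (1 / (2 * r)) • A)
      + (-r) ^ n • ((1 / (2 * r ^ 2)) • A ^ 2 - (1 / (2 * r)) • A)
      + (0 : ℝ) ^ n • (1 - (1 / r ^ 2) • A ^ 2) := by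
    have h3 : A ^ 2 * A = r ^ 2 • A := by rw [← pow_succ, h]
    have h4 : A * A = A ^ 2 := (pow_two A).symm
    intro n
    induction n with
    | zero => simp only [pow_zero, one_smul]; module
    | succ n ih =>
      rw [pow_succ, ih]
      simp only [add_mul, sub_mul, smul_mul_assoc, one_mul, h3, h4, smul_smul, smul_add, smul_sub]
      match_scalars <;> field_simp <;> ring
  have hs : ∀ t : ℝ, HasSum (fun n : ℕ => (n.factorial : ℝ)⁻¹ * t ^ n) (Real.exp t) := by
    intro t
    have := NormedSpace.exp_series_hasSum_exp' (𝕂 := ℝ) t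
    rw [← Real.exp_eq_exp_ℝ] at this
    simpa using this
  have hsum : HasSum (fun n : ℕ => ((n.factorial : ℝ)⁻¹) • A ^ n)
      (Real.exp r • ((1 / (2 * r ^ 2)) • A ^ 2 + (1 / (2 * r)) • A)
      + Real.exp (-r) • ((1 / (2 * r ^ 2)) • A ^ 2 - (1 / (2 * r)) • A)
      + Real.exp 0 • (1 - (1 / r ^ 2) • A ^ 2)) := by
    have := (((hs r).smul_const ((1 / (2 * r ^ 2)) • A ^ 2 + (1 / (2 * r)) • A)).add
      ((hs (-r)).smul_const ((1 / (2 * r ^ 2)) • A ^ 2 - (1 / (2 * r)) • A))).add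
      ((hs 0).smul_const (1 - (1 / r ^ 2) • A ^ 2))
    refine HasSum.congr_fun this fun n => ?_
    rw [hpow n]
    simp only [smul_add, mul_smul]
  rw [NormedSpace.exp_eq_tsum ℝ]
  change ∑' n : ℕ, ((n.factorial : ℝ)⁻¹) • A ^ n = _
  rw [hsum.tsum_eq, Real.sinh_eq, Real.cosh_eq, Real.exp_zero]
  match_scalars <;> field_simp <;> ring

end MatrixExp

/-! ### Quantization of products of orthogonal vectors -/

theorem contractLeft_prod_eq_zero {d : Module.Dual ℝ Mink} (l : List Mink)
    (h : ∀ v ∈ l, d v = 0) : contractLeft d ((l.map (ι minkQ)).prod) = 0 := by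
  induction l with
  | nil => simp
  | cons v l ih =>
    rw [List.map_cons, List.prod_cons, contractLeft_ι_mul, h v (by simp),
      ih fun w hw => h w (by simp [hw])]
    simp

/-- Pulling out a vector costs a contraction of the remaining product with the polar form, and
orthogonality kills it. -/
theorem quantize_prod (l : List Mink)
    (h : l.Pairwise fun v w => QuadraticMap.polar minkQ v w = 0) :
    quantize ((l.map (ExteriorAlgebra.ι ℝ)).prod) = (l.map (ι minkQ)).prod := by
  induction l with
  | nil =>
    simp only [List.map_nil, List.prod_nil, quantize, equivExterior, changeFormEquiv_symm,
      changeFormEquiv_apply]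
    exact changeForm_one _
  | cons v l ih =>
    rw [List.pairwise_cons] at h
    have ih' := ih h.2
    simp only [quantize, equivExterior, changeFormEquiv_symm, changeFormEquiv_apply] at ih' ⊢
    rw [List.map_cons, List.prod_cons]
    erw [changeForm_ι_mul]
    rw [ih', contractLeft_prod_eq_zero, sub_zero, List.map_cons, List.prod_cons]
    intro w hw
    have h2 := h.1 w hw
    simp only [QuadraticMap.polar] at h2
    simp [QuadraticMap.associated_apply]
    linarith

theorem mul_prod_iota {g : Cl} {A : Matrix (Fin 11) (Fin 11) ℝ}
    (hg : ∀ x, g * ι minkQ x = ι minkQ (A.mulVec x) * g) (l : List Mink) :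
    g * (l.map (ι minkQ)).prod = ((l.map A.mulVec).map (ι minkQ)).prod * g := by
  induction l with
  | nil => simp
  | cons v l ih =>
    simp only [List.map_cons, List.prod_cons]
    rw [← mul_assoc, hg, mul_assoc, ih, mul_assoc]

/-- The polar form is the anticommutator of vectors, a scalar, so conjugation fixes it. A one-sided
inverse of `g` suffices, which also covers the boosts, whose lifts are not placed in the spin group.
-/
theorem polar_mulVec {g g' : Cl} (hgg : g * g' = 1) {A : Matrix (Fin 11) (Fin 11) ℝ}
    (hg : ∀ x, g * ι minkQ x = ι minkQ (A.mulVec x) * g) (x y : Mink) :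
    QuadraticMap.polar minkQ (A.mulVec x) (A.mulVec y) = QuadraticMap.polar minkQ x y := by
  apply (algebraMap ℝ Cl).injective
  have h (z : Mink) : ι minkQ (A.mulVec z) = g * ι minkQ z * g' := by
    rw [hg, mul_assoc, hgg, mul_one]
  have h2 (z w : Mink) :
      ι minkQ (A.mulVec z) * ι minkQ (A.mulVec w) = g * (ι minkQ z * ι minkQ w) * g' := by
    rw [h w, ← mul_assoc, ← mul_assoc, ← hg]
    simp only [mul_assoc]
  rw [← ι_mul_ι_add_swap, h2, h2, ← add_mul, ← mul_add, ι_mul_ι_add_swap, ← Algebra.commutes,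
    mul_assoc, hgg, mul_one]

/-- The vectors which span the brane. -/
def braneFrame : List Mink := [e 0, e 1, e 3, e 5, e 7, e 9]

theorem braneFrame_pairwise :
    braneFrame.Pairwise fun v w => QuadraticMap.polar minkQ v w = 0 := by
  simp only [braneFrame, List.pairwise_cons, List.mem_cons, List.not_mem_nil, or_false,
    forall_eq_or_imp, forall_eq, polar_e]
  simp [e]

theorem brane_eq_prod : brane = (braneFrame.map (ExteriorAlgebra.ι ℝ)).prod := by
  simp [brane, braneFrame, ExteriorAlgebra.ιMulti_apply]

theorem quantize_brane : quantize brane = (braneFrame.map (ι minkQ)).prod := by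
  rw [brane_eq_prod, quantize_prod _ braneFrame_pairwise]

/-- A lift of `A` conjugates the Clifford element of the brane to the one of its image under `A`. -/
theorem quantize_transform_mul {g g' : Cl} (hgg : g * g' = 1) {A : Matrix (Fin 11) (Fin 11) ℝ}
    (hg : ∀ x, g * ι minkQ x = ι minkQ (A.mulVec x) * g) :
    quantize (transform A brane) * g = g * quantize brane := by
  have h : transform A brane = ((braneFrame.map A.mulVec).map (ExteriorAlgebra.ι ℝ)).prod := by
    rw [transform, brane_eq_prod, map_list_prod]
    simp [braneFrame]
  rw [h, quantize_prod, quantize_brane, mul_prod_iota hg]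
  rw [List.pairwise_map]
  exact braneFrame_pairwise.imp fun {v w} h => by rw [polar_mulVec hgg hg, h]

/-! ### Lifts to the spin group -/

/-- Both vectors are invertible, hence in the Lipschitz group, and `star` reverses the product. The
lifts of plane rotations and of null rotations are products of two such vectors. -/
theorem iota_mul_iota_mem_spinGroup {u w : Mink} (h : minkQ u * minkQ w = 1) :
    ι minkQ u * ι minkQ w ∈ spinGroup minkQ := by
  have hu : minkQ u ≠ 0 := left_ne_zero_of_mul_eq_one h
  have hw : minkQ w ≠ 0 := right_ne_zero_of_mul_eq_one h
  have hunit (v : Mink) (hv : minkQ v ≠ 0) :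
      ∃ y : Clˣ, y ∈ lipschitzGroup minkQ ∧ (y : Cl) = ι minkQ v := by
    have h1 : ι minkQ v * ((minkQ v)⁻¹ • ι minkQ v) = 1 := by
      rw [mul_smul_comm, ι_sq_scalar, Algebra.algebraMap_eq_smul_one, smul_smul,
        inv_mul_cancel₀ hv, one_smul]
    have h2 : ((minkQ v)⁻¹ • ι minkQ v) * ι minkQ v = 1 := by
      rw [smul_mul_assoc, ι_sq_scalar, Algebra.algebraMap_eq_smul_one, smul_smul,
        inv_mul_cancel₀ hv, one_smul]
    exact ⟨⟨_, _, h1, h2⟩, Subgroup.subset_closure ⟨v, rfl⟩, rfl⟩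
  obtain ⟨y, hy, hyu⟩ := hunit u hu
  obtain ⟨z, hz, hzw⟩ := hunit w hw
  have hsc (a b : Mink) (hab : minkQ a * minkQ b = 1) :
      ι minkQ a * ι minkQ b * (ι minkQ b * ι minkQ a) = 1 := by
    rw [mul_assoc, ← mul_assoc (ι minkQ b), ι_sq_scalar, ← Algebra.smul_def, mul_smul_comm,
      ι_sq_scalar, Algebra.algebraMap_eq_smul_one, smul_smul, mul_comm, hab, one_smul]
  refine ⟨⟨⟨y * z, mul_mem hy hz, by simp [hyu, hzw]⟩, ?_⟩, ι_mul_ι_mem_evenOdd_zero _ _ _⟩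
  have hstar : star (ι minkQ u * ι minkQ w) = ι minkQ w * ι minkQ u := by
    simp
  rw [SetLike.mem_coe, Unitary.mem_iff, hstar]
  exact ⟨hsc _ _ (by rw [mul_comm, h]), hsc _ _ h⟩

theorem IsSpinLift.mul {g h : Cl} {A B : Matrix (Fin 11) (Fin 11) ℝ} (hg : IsSpinLift g A)
    (hh : IsSpinLift h B) : IsSpinLift (g * h) (A * B) := by
  refine ⟨mul_mem hg.1 hh.1, fun x => ?_⟩
  rw [mul_assoc, hh.2, ← mul_assoc, hg.2, mul_assoc, Matrix.mulVec_mulVec]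

theorem Gam_mul_Gam_sq {j k : Fin 11} (h : j ≠ k) :
    Gam j * Gam k * (Gam j * Gam k) = algebraMap ℝ Cl (-(eta j * eta k)) := by
  rw [mul_assoc, ← mul_assoc (Gam k), Gam_anticomm h.symm, neg_mul, mul_assoc (Gam j), Gam_sq k,
    mul_neg, ← mul_assoc, Gam_sq j, ← map_mul, map_neg]

theorem minkQ_smul_add_smul {j k : Fin 11} (h : j ≠ k) (a b : ℝ) :
    minkQ (a • e j + b • e k) = a ^ 2 * eta j + b ^ 2 * eta k := by
  have h1 := QuadraticMap.map_add minkQ (a • e j) (b • e k)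
  rw [h1, QuadraticMap.polar_smul_right, polar_e, QuadraticMap.map_smul, QuadraticMap.map_smul,
    minkQ_e, minkQ_e]
  simp [e, h]
  ring

theorem halfRot_isSpinLift {j k : Fin 11} (hjk : j ≠ k) (hj : j ≠ 0) (hk : k ≠ 0) (t : ℝ) :
    IsSpinLift (halfRot j k t) (planeRot j k t) := by
  have ej : eta j = 1 := by simp [eta, hj]
  have ek : eta k = 1 := by simp [eta, hk]
  constructor
  · have : halfRot j k t =
        ι minkQ (Real.sin (t / 2) • e j + Real.cos (t / 2) • e k) * ι minkQ (e k) := by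
      rw [map_add, map_smul, map_smul, add_mul, smul_mul_assoc, smul_mul_assoc]
      change _ = Real.sin (t / 2) • (Gam j * Gam k) + Real.cos (t / 2) • (Gam k * Gam k)
      rw [Gam_sq, ek, map_one, halfRot, Algebra.algebraMap_eq_smul_one, add_comm]
    rw [this]
    apply iota_mul_iota_mem_spinGroup
    rw [minkQ_smul_add_smul hjk, minkQ_e, ej, ek]
    simp
  · intro x
    have hp := conj_iota (commutator_Gam_mul_Gam j k) (Gam_mul_Gam_sq hjk)
      (p := Real.cos (t / 2)) (q := Real.sin (t / 2)) (by rw [ej, ek]; simp) x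
    rw [halfRot, hp]
    congr 3
    have h1 : 2 * Real.cos (t / 2) * Real.sin (t / 2) = Real.sin t := by
      rw [mul_right_comm, ← Real.sin_two_mul]; congr 1; ring
    have h2 : 2 * Real.sin (t / 2) ^ 2 = 1 - Real.cos t := by
      have : Real.cos t = Real.cos (2 * (t / 2)) := by congr 1; ring
      rw [this, Real.cos_two_mul, Real.cos_sq']; ring
    rw [h1, h2, planeRot, lorentzGen, ej, ek]
    have hsq : ((1 : ℝ) • Matrix.single j k (1 : ℝ) - (1 : ℝ) • Matrix.single k j 1) ^ 2 =
        -(Matrix.single j j 1 + Matrix.single k k 1) := by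
      rw [one_smul, one_smul, pow_two, sub_mul, mul_sub, mul_sub,
        Matrix.single_mul_single_of_ne (h := hjk.symm), Matrix.single_mul_single_same,
        Matrix.single_mul_single_same, Matrix.single_mul_single_of_ne (h := hjk)]
      simp
      abel
    rw [hsq, one_smul, one_smul]
    module

theorem Rhat_isSpinLift (θ : Fin 4 → ℝ) : IsSpinLift (Rhat θ) (torusRot θ) :=
  (((halfRot_isSpinLift (by decide) (by decide) (by decide) _).mul
    (halfRot_isSpinLift (by decide) (by decide) (by decide) _)).mul
    (halfRot_isSpinLift (by decide) (by decide) (by decide) _)).mul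
    (halfRot_isSpinLift (by decide) (by decide) (by decide) _)

theorem commutator_Nhat (α β : ℝ) (x : Mink) :
    Nhat α β * ι minkQ x - ι minkQ x * Nhat α β =
      (2 : ℝ) • ι minkQ ((α • lorentzGen 0 10 + β • lorentzGen 9 10).mulVec x) := by
  have h0 := commutator_Gam_mul_Gam 0 10 x
  have h9 := commutator_Gam_mul_Gam 9 10 x
  rw [Matrix.add_mulVec, Matrix.smul_mulVec, Matrix.smul_mulVec, map_add, map_smul, map_smul,
    smul_add, smul_comm _ α, smul_comm _ β, ← h0, ← h9, Nhat]
  simp only [add_mul, mul_add, smul_mul_assoc, mul_smul_comm, smul_sub]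
  abel

theorem Nhat_eq (α β : ℝ) : Nhat α β = ι minkQ (α • e 0 + β • e 9) * Gam 10 := by
  rw [map_add, map_smul, map_smul, add_mul, smul_mul_assoc, smul_mul_assoc]
  rfl

/-- `N̂ = v Γ♮` with `v` orthogonal to `e♮`, so its square is `-Q(v)`; this separates boosts from
null rotations. -/
theorem Nhat_sq (α β : ℝ) : Nhat α β * Nhat α β = algebraMap ℝ Cl (α ^ 2 - β ^ 2) := by
  have h : Gam 10 * ι minkQ (α • e 0 + β • e 9) = -(ι minkQ (α • e 0 + β • e 9) * Gam 10) := by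
    rw [iota_mul_Gam]
    simp [e]
  rw [Nhat_eq, mul_assoc, ← mul_assoc (Gam 10), h, neg_mul, mul_assoc, Gam_sq, mul_neg, ← mul_assoc,
    ι_sq_scalar, minkQ_smul_add_smul (by decide), ← map_mul, ← map_neg]
  congr 1
  simp [eta]
  ring

theorem one_add_Nhat_isSpinLift {α β : ℝ} (h : α ^ 2 = β ^ 2) :
    IsSpinLift (1 + (1 / 2 : ℝ) • Nhat α β) (lorentzS α β) := by
  have hsq : Nhat α β * Nhat α β = algebraMap ℝ Cl 0 := by rw [Nhat_sq, h, sub_self]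
  constructor
  · have : 1 + (1 / 2 : ℝ) • Nhat α β =
        ι minkQ (e 10 + (1 / 2 : ℝ) • (α • e 0 + β • e 9)) * ι minkQ (e 10) := by
      rw [map_add, add_mul, ι_sq_scalar, minkQ_e, map_smul, smul_mul_assoc, Nhat_eq, Gam]
      simp [eta]
    rw [this]
    apply iota_mul_iota_mem_spinGroup
    rw [QuadraticMap.map_add minkQ (e 10), QuadraticMap.polar_comm, polar_e, QuadraticMap.map_smul,
      minkQ_smul_add_smul (by decide), minkQ_e]
    simp [eta, e, h]
  · intro x
    have hA := generator_cube (commutator_Nhat α β) hsq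
    rw [zero_smul] at hA
    have hp := conj_iota (commutator_Nhat α β) hsq (p := 1) (q := 1 / 2) (by norm_num) x
    rw [map_one] at hp
    rw [hp, lorentzS, exp_of_cube_eq_zero _ hA]
    norm_num

/-- The lift of a boost. -/
def boostLift (α β r : ℝ) : Cl :=
  algebraMap ℝ Cl (Real.cosh (r / 2)) + (Real.sinh (r / 2) / r) • Nhat α β

theorem boostLift_mul_iota {α β r : ℝ} (hr : r ≠ 0) (h : r ^ 2 = α ^ 2 - β ^ 2) (x : Mink) :
    boostLift α β r * ι minkQ x = ι minkQ ((lorentzS α β).mulVec x) * boostLift α β r := by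
  have hsq : Nhat α β * Nhat α β = algebraMap ℝ Cl (r ^ 2) := by rw [Nhat_sq, h]
  have hA := generator_cube (commutator_Nhat α β) hsq
  have hp := conj_iota (commutator_Nhat α β) hsq (p := Real.cosh (r / 2))
    (q := Real.sinh (r / 2) / r) (by field_simp; exact Real.cosh_sq_sub_sinh_sq _) x
  rw [boostLift, hp, lorentzS, exp_of_cube_eq _ hr hA]
  have h1 : Real.sinh r = 2 * Real.sinh (r / 2) * Real.cosh (r / 2) := by
    rw [← Real.sinh_two_mul]; congr 1; ring
  have h2 : Real.cosh r = 1 + 2 * Real.sinh (r / 2) ^ 2 := by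
    have : Real.cosh r = Real.cosh (2 * (r / 2)) := by congr 1; ring
    rw [this, Real.cosh_two_mul, Real.cosh_sq]; ring
  have h3 : 2 * Real.cosh (r / 2) * (Real.sinh (r / 2) / r) = Real.sinh r / r := by
    rw [h1]; ring
  have h4 : 2 * (Real.sinh (r / 2) / r) ^ 2 = (Real.cosh r - 1) / r ^ 2 := by
    rw [h2]; ring
  rw [h3, h4]

/-! ### Monomials in the generators -/

/-- The product of the generators with the given indices. -/
def mono (l : List (Fin 11)) : Cl := (l.map Gam).prod

/-- The sign (`true` for minus) and the sorted monomial of `Γ_i` times a sorted monomial. -/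
def insertGen (i : Fin 11) : List (Fin 11) → Bool × List (Fin 11)
  | [] => (false, [i])
  | j :: l =>
    if i < j then (false, i :: j :: l)
    else if i = j then (decide (i = 0), l)
    else (!(insertGen i l).1, j :: (insertGen i l).2)

/-- The sign and the sorted squarefree monomial to which a monomial reduces. -/
def normalForm : List (Fin 11) → Bool × List (Fin 11)
  | [] => (false, [])
  | i :: l =>
    (xor (normalForm l).1 (insertGen i (normalForm l).2).1, (insertGen i (normalForm l).2).2)

/-- The Clifford element of a monomial with sign. -/
def signedMono (r : Bool × List (Fin 11)) : Cl := if r.1 then -mono r.2 else mono r.2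

theorem mono_nil : mono [] = 1 := rfl

theorem mono_cons (i : Fin 11) (l : List (Fin 11)) : mono (i :: l) = Gam i * mono l := rfl

theorem mono_append (l m : List (Fin 11)) : mono (l ++ m) = mono l * mono m := by
  simp [mono]

theorem Gam_mul_mono (i : Fin 11) (l : List (Fin 11)) :
    Gam i * mono l = signedMono (insertGen i l) := by
  induction l with
  | nil => simp [insertGen, signedMono, mono]
  | cons j l ih =>
    rw [insertGen]
    split_ifs with h1 h2
    · rfl
    · subst h2
      rw [mono_cons, ← mul_assoc, Gam_sq]
      by_cases h : i = 0 <;> simp [h, eta, signedMono]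
    · rw [mono_cons, ← mul_assoc, Gam_anticomm h2, neg_mul, mul_assoc, ih]
      rcases insertGen i l with ⟨_ | _, m⟩ <;> simp [signedMono, mono_cons]

/-- This turns Clifford relations between monomials into a computation with lists, so that `decide`
can settle them. Only the implication from equal normal forms to equal elements is needed, not the
independence of monomials. -/
theorem mono_eq_signedMono (l : List (Fin 11)) : mono l = signedMono (normalForm l) := by
  induction l with
  | nil => rfl
  | cons i l ih =>
    rw [mono_cons, ih, normalForm]
    have h := Gam_mul_mono i (normalForm l).2
    rcases hl : normalForm l with ⟨_ | _, m⟩ <;> rw [hl] at h <;>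
      rcases hi : insertGen i m with ⟨_ | _, k⟩ <;> simp [signedMono, hi] at h ⊢ <;> simp [h]

theorem mono_mul_mono {l m : List (Fin 11)} (k : List (Fin 11))
    (h : normalForm (l ++ m) = normalForm k) : mono l * mono m = mono k := by
  rw [← mono_append, mono_eq_signedMono, h, ← mono_eq_signedMono]

theorem mono_mul_mono_neg {l m : List (Fin 11)} (k : List (Fin 11))
    (h : normalForm (l ++ m) = (!(normalForm k).1, (normalForm k).2)) :
    mono l * mono m = -mono k := by
  rw [← mono_append, mono_eq_signedMono, h, mono_eq_signedMono k]
  rcases normalForm k with ⟨_ | _, k⟩ <;> simp [signedMono]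

theorem mono_commute {l m : List (Fin 11)} (h : normalForm (l ++ m) = normalForm (m ++ l)) :
    Commute (mono l) (mono m) := by
  rw [Commute, SemiconjBy, mono_mul_mono _ h, mono_append]

theorem mono_anticommute {l m : List (Fin 11)}
    (h : normalForm (l ++ m) = (!(normalForm (m ++ l)).1, (normalForm (m ++ l)).2)) :
    mono l * mono m = -(mono m * mono l) := by
  rw [mono_mul_mono_neg _ h, mono_append]

theorem Gam_commute_mono_or (i : Fin 11) (m : List (Fin 11)) :
    Gam i * mono m = mono m * Gam i ∨ Gam i * mono m = -(mono m * Gam i) := by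
  induction m with
  | nil => simp [mono_nil]
  | cons j m ih =>
    rw [mono_cons]
    have hij : Gam i * Gam j = Gam j * Gam i ∨ Gam i * Gam j = -(Gam j * Gam i) := by
      by_cases h : i = j
      · subst h; simp
      · exact Or.inr (Gam_anticomm h)
    rw [← mul_assoc, mul_assoc (Gam j)]
    rcases hij with hij | hij <;> rcases ih with ih | ih <;> simp [hij, mul_assoc, ih]

theorem mono_commute_or (l m : List (Fin 11)) :
    mono l * mono m = mono m * mono l ∨ mono l * mono m = -(mono m * mono l) := by
  induction l with
  | nil => simp [mono_nil]
  | cons i l ih =>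
    rw [mono_cons, ← mul_assoc, mul_assoc]
    rcases ih with ih | ih <;> rcases Gam_commute_mono_or i m with h | h <;>
      simp [ih, ← mul_assoc, h]

theorem mono_mul_self_or (l : List (Fin 11)) : mono l * mono l = 1 ∨ mono l * mono l = -1 := by
  induction l with
  | nil => simp [mono_nil]
  | cons i l ih =>
    have hi : Gam i * Gam i = 1 ∨ Gam i * Gam i = -1 := by
      by_cases h : i = 0 <;> simp [Gam_sq, eta, h]
    have h : Gam i * mono l * (Gam i * mono l) = Gam i * Gam i * (mono l * mono l) ∨
        Gam i * mono l * (Gam i * mono l) = -(Gam i * Gam i * (mono l * mono l)) := by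
      have h1 : Gam i * mono l * (Gam i * mono l) = Gam i * (mono l * Gam i) * mono l := by
        simp only [mul_assoc]
      rw [h1]
      rcases Gam_commute_mono_or i l with h | h
      · left; rw [← h]; simp only [mul_assoc]
      · right; rw [eq_neg_iff_add_eq_zero.2 (by rw [h, add_neg_cancel] :
          mono l * Gam i + Gam i * mono l = 0)]; simp only [mul_assoc, mul_neg, neg_mul]
    rw [mono_cons]
    rcases hi with hi | hi <;> rcases ih with ih | ih <;> rcases h with h | h <;>
      simp [h, hi, ih]

theorem isUnit_mono (l : List (Fin 11)) : IsUnit (mono l) := by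
  rcases mono_mul_self_or l with h | h
  · exact ⟨⟨_, _, h, h⟩, rfl⟩
  · exact ⟨⟨mono l, -mono l, by simp [h], by simp [h]⟩, rfl⟩

/-- A subalgebra does not see signs, so only supports are compared. -/
theorem mono_mem_of_mul {S : Subalgebra ℝ Cl} {l m : List (Fin 11)} (k : List (Fin 11))
    (hl : mono l ∈ S) (hm : mono m ∈ S) (h : (normalForm (l ++ m)).2 = (normalForm k).2) :
    mono k ∈ S := by
  have hlm := mul_mem hl hm
  rw [← mono_append, mono_eq_signedMono] at hlm
  rw [mono_eq_signedMono]
  rcases hk : normalForm k with ⟨_ | _, k⟩ <;> rcases hr : normalForm (l ++ m) with ⟨_ | _, r⟩ <;>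
    simp_all [signedMono]

section Spinors

variable {Δ : Type*} [AddCommGroup Δ] [Module ℝ Δ] [Module Cl Δ] [IsScalarTower ℝ Cl Δ]

/-! ### Eigenspaces of Clifford elements -/

variable (Δ) in
/-- The eigenspace `{ε | a · ε = c ε}`. -/
def eigen (a : Cl) (c : ℝ) : Submodule ℝ Δ :=
  LinearMap.eqLocus (Algebra.lsmul ℝ ℝ Δ a) (c • LinearMap.id)

theorem mem_eigen {a : Cl} {c : ℝ} {ε : Δ} : ε ∈ eigen Δ a c ↔ a • ε = c • ε := Iff.rfl

/-- The subalgebra of the elements which map a subspace of spinors to itself. -/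
def stabilizer (V : Submodule ℝ Δ) : Subalgebra ℝ Cl where
  carrier := {a | ∀ ε ∈ V, a • ε ∈ V}
  mul_mem' ha hb ε hε := by rw [mul_smul]; exact ha _ (hb _ hε)
  add_mem' ha hb ε hε := by rw [add_smul]; exact V.add_mem (ha _ hε) (hb _ hε)
  algebraMap_mem' r ε hε := by rw [algebraMap_smul]; exact V.smul_mem r hε

theorem mem_stabilizer_eigen {a b : Cl} (h : Commute a b) (c : ℝ) :
    a ∈ stabilizer (eigen Δ b c) := by
  intro ε hε
  rw [mem_eigen] at hε ⊢
  rw [← mul_smul, ← h.eq, mul_smul, hε, smul_comm]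

theorem mem_stabilizer_inf {V W : Submodule ℝ Δ} {a : Cl} (hV : a ∈ stabilizer V)
    (hW : a ∈ stabilizer W) : a ∈ stabilizer (V ⊓ W) :=
  fun ε hε => ⟨hV ε hε.1, hW ε hε.2⟩

theorem sup_eigen_eq {a : Cl} (ha : a * a = 1) {V : Submodule ℝ Δ} (hV : a ∈ stabilizer V) :
    V ⊓ eigen Δ a 1 ⊔ V ⊓ eigen Δ a (-1) = V := by
  refine le_antisymm (sup_le inf_le_left inf_le_left) fun ε hε => ?_
  have h2 : a • a • ε = ε := by rw [← mul_smul, ha, one_smul]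
  have hp : ε = (1 / 2 : ℝ) • (ε + a • ε) + (1 / 2 : ℝ) • (ε - a • ε) := by
    generalize a • ε = η
    module
  rw [hp]
  refine Submodule.add_mem_sup ⟨V.smul_mem _ (V.add_mem hε (hV _ hε)), ?_⟩
    ⟨V.smul_mem _ (V.sub_mem hε (hV _ hε)), ?_⟩
  · rw [SetLike.mem_coe, mem_eigen, smul_comm a, smul_add, h2]; generalize a • ε = η; module
  · rw [SetLike.mem_coe, mem_eigen, smul_comm a, smul_sub, h2]; generalize a • ε = η; module

theorem disjoint_eigen (a : Cl) (V : Submodule ℝ Δ) :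
    (V ⊓ eigen Δ a 1) ⊓ (V ⊓ eigen Δ a (-1)) = ⊥ := by
  rw [eq_bot_iff]
  rintro ε ⟨⟨-, h1⟩, -, h2⟩
  rw [SetLike.mem_coe, mem_eigen] at h1 h2
  rw [h1] at h2
  have h3 : (2 : ℝ) • ε = 0 := by linear_combination (norm := module) (1 : ℝ) • h2
  simpa using h3

theorem finrank_add_finrank_eigen [FiniteDimensional ℝ Δ] {a : Cl} (ha : a * a = 1)
    {V : Submodule ℝ Δ} (hV : a ∈ stabilizer V) :
    Module.finrank ℝ ↥(V ⊓ eigen Δ a 1) + Module.finrank ℝ ↥(V ⊓ eigen Δ a (-1)) =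
      Module.finrank ℝ V := by
  rw [← Submodule.finrank_sup_add_finrank_inf_eq, sup_eigen_eq ha hV, disjoint_eigen]
  simp

theorem finrank_eigen_le_neg [FiniteDimensional ℝ Δ] {a x : Cl}
    (hx : IsUnit x) (hax : a * x = -(x * a)) {V : Submodule ℝ Δ} (hV : x ∈ stabilizer V) (c : ℝ) :
    Module.finrank ℝ ↥(V ⊓ eigen Δ a c) ≤ Module.finrank ℝ ↥(V ⊓ eigen Δ a (-c)) := by
  have hinj : Function.Injective (Algebra.lsmul ℝ ℝ Δ x) := by
    obtain ⟨u, rfl⟩ := hx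
    intro ε ε' h
    have h' : (u : Cl) • ε = (u : Cl) • ε' := h
    simpa [← mul_smul] using congrArg (fun η => (↑u⁻¹ : Cl) • η) h'
  have hmap : ∀ ε ∈ V ⊓ eigen Δ a c, Algebra.lsmul ℝ ℝ Δ x ε ∈ V ⊓ eigen Δ a (-c) := by
    rintro ε ⟨h1, h2⟩
    refine ⟨hV _ h1, ?_⟩
    rw [SetLike.mem_coe, mem_eigen] at h2 ⊢
    rw [Algebra.lsmul_coe, ← mul_smul, hax, neg_smul, mul_smul, h2, neg_smul, smul_comm]
  refine LinearMap.finrank_le_finrank_of_injective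
    (f := (Algebra.lsmul ℝ ℝ Δ x : Δ →ₗ[ℝ] Δ).restrict hmap) fun ε ε' h => ?_
  exact Subtype.ext (hinj (congrArg Subtype.val h))

/-- An operator which preserves `V` and anticommutes with the involution `a` exchanges the two
eigenspaces of `a` in `V`, so each of them is one half of `V`. -/
theorem two_mul_finrank_inf_eigen [FiniteDimensional ℝ Δ] {a x : Cl} (ha : a * a = 1)
    (hx : IsUnit x) (hax : a * x = -(x * a)) {V : Submodule ℝ Δ} (haV : a ∈ stabilizer V)
    (hxV : x ∈ stabilizer V) {c : ℝ} (hc : c = 1 ∨ c = -1) :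
    2 * Module.finrank ℝ ↥(V ⊓ eigen Δ a c) = Module.finrank ℝ V := by
  have h1 := finrank_eigen_le_neg hx hax hxV 1
  have h2 := finrank_eigen_le_neg hx hax hxV (-1)
  have h3 := finrank_add_finrank_eigen ha haV
  rw [neg_neg] at h2
  rcases hc with rfl | rfl <;> omega

end Spinors

section Spinors

variable {Δ : Type*} [AddCommGroup Δ] [Module ℝ Δ] [Module Cl Δ] [IsScalarTower ℝ Cl Δ]

/-! ### The dimension of the spinor representation -/

theorem inf_eigen_ne_bot {a : Cl} (ha : a * a = 1) {V : Submodule ℝ Δ} (hV : a ∈ stabilizer V)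
    (hne : V ≠ ⊥) : ∃ c : ℝ, V ⊓ eigen Δ a c ≠ ⊥ := by
  by_contra! h
  rw [← sup_eigen_eq ha hV, h, h, sup_bot_eq] at hne
  exact hne rfl

/-- Involutions split every stable subspace explicitly, so this is available before `Δ` is known to
be finite-dimensional. -/
theorem exists_joint_eigenvector (L : List Cl) (hsq : ∀ a ∈ L, a * a = 1)
    (hcomm : L.Pairwise Commute) (V : Submodule ℝ Δ) (hV : V ≠ ⊥)
    (hstab : ∀ a ∈ L, a ∈ stabilizer V) :
    ∃ v ∈ V, v ≠ 0 ∧ ∀ a ∈ L, ∃ c : ℝ, a • v = c • v := by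
  induction L generalizing V with
  | nil =>
    obtain ⟨v, hv, hne⟩ := V.ne_bot_iff.1 hV
    exact ⟨v, hv, hne, by simp⟩
  | cons a L ih =>
    rw [List.pairwise_cons] at hcomm
    simp only [List.mem_cons, forall_eq_or_imp] at hsq hstab
    obtain ⟨c, hc⟩ := inf_eigen_ne_bot hsq.1 hstab.1 hV
    obtain ⟨v, hv, hne, h⟩ := ih hsq.2 hcomm.2 _ hc fun b hb =>
      mem_stabilizer_inf (hstab.2 b hb) (mem_stabilizer_eigen (hcomm.1 b hb).symm c)
    refine ⟨v, hv.1, hne, ?_⟩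
    simp only [List.mem_cons, forall_eq_or_imp]
    exact ⟨⟨c, hv.2⟩, h⟩

/-- The sum of a subspace and its image under a Clifford element. -/
def double (W : Submodule ℝ Δ) (x : Cl) : Submodule ℝ Δ := W ⊔ W.map (Algebra.lsmul ℝ ℝ Δ x)

theorem le_double (W : Submodule ℝ Δ) (x : Cl) : W ≤ double W x := le_sup_left

theorem smul_mem_double {W : Submodule ℝ Δ} (x : Cl) {ε : Δ} (hε : ε ∈ W) :
    x • ε ∈ double W x :=
  Submodule.mem_sup_right ⟨ε, hε, rfl⟩

theorem mem_stabilizer_double {W : Submodule ℝ Δ} {x g : Cl}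
    (h1 : ∀ ε ∈ W, g • ε ∈ double W x) (h2 : ∀ ε ∈ W, (g * x) • ε ∈ double W x) :
    g ∈ stabilizer (double W x) := by
  intro ε hε
  obtain ⟨η, hη, _, ⟨ζ, hζ, rfl⟩, rfl⟩ := Submodule.mem_sup.1 hε
  rw [smul_add]
  refine add_mem (h1 η hη) ?_
  rw [Algebra.lsmul_coe, ← mul_smul]
  exact h2 ζ hζ

/-- Monomials commute up to sign, so one that preserves `W` also preserves `x W`; and `x` itself
exchanges `W` and `x W` because `x² = ±1`. -/
theorem mono_mem_stabilizer_double {W : Submodule ℝ Δ} (x l : List (Fin 11))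
    (h : mono l ∈ stabilizer W ∨ l = x) : mono l ∈ stabilizer (double W (mono x)) := by
  rcases h with h | rfl
  · refine mem_stabilizer_double (fun ε hε => le_double _ _ (h ε hε)) fun ε hε => ?_
    have h1 := smul_mem_double (mono x) (h ε hε)
    rw [← mul_smul] at h1
    rcases mono_commute_or l x with h2 | h2 <;> rw [h2]
    · exact h1
    · rw [neg_smul]; exact neg_mem h1
  · refine mem_stabilizer_double (fun ε hε => smul_mem_double _ hε) fun ε hε => ?_
    have h1 := le_double W (mono l) hε
    rcases mono_mul_self_or l with h2 | h2 <;> rw [h2]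
    · rwa [one_smul]
    · rw [neg_smul, one_smul]; exact neg_mem h1

theorem finrank_double_le (W : Submodule ℝ Δ) [FiniteDimensional ℝ W] (x : Cl) :
    FiniteDimensional ℝ (double W x) ∧
      Module.finrank ℝ (double W x) ≤ 2 * Module.finrank ℝ W := by
  refine ⟨Submodule.finiteDimensional_sup _ _, ?_⟩
  have h1 := Submodule.finrank_add_le_finrank_add_finrank W (W.map (Algebra.lsmul ℝ ℝ Δ x))
  have h2 := Submodule.finrank_map_le (Algebra.lsmul ℝ ℝ Δ x : Δ →ₗ[ℝ] Δ) W
  exact h1.trans (by rw [two_mul]; exact Nat.add_le_add_left h2 _)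

theorem stabilizer_eq_top_of_Gam {W : Submodule ℝ Δ} (h : ∀ i, mono [i] ∈ stabilizer W) :
    stabilizer W = ⊤ := by
  rw [eq_top_iff, ← adjoin_range_ι, Algebra.adjoin_le_iff]
  rintro _ ⟨x, rfl⟩
  have hx : x = ∑ i, x i • e i := by
    ext k
    simp [e, Pi.single_apply]
  rw [hx, map_sum]
  refine sum_mem fun i _ => ?_
  rw [map_smul]
  have := h i
  rw [mono_cons, mono_nil, mul_one] at this
  exact (stabilizer W).smul_mem this _

theorem eq_top_of_stabilizer_eq_top [IsSimpleModule Cl Δ] {W : Submodule ℝ Δ} (hne : W ≠ ⊥)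
    (h : stabilizer W = ⊤) : W = ⊤ := by
  let W' : Submodule Cl Δ :=
    { carrier := W
      add_mem' := W.add_mem
      zero_mem' := W.zero_mem
      smul_mem' := fun a ε hε => (h.symm ▸ Algebra.mem_top : a ∈ stabilizer W) ε hε }
  have hmem : ∀ ε, ε ∈ W' ↔ ε ∈ W := fun ε => Iff.rfl
  rcases eq_bot_or_eq_top W' with h' | h'
  · refine absurd ?_ hne
    rw [eq_bot_iff]
    intro ε hε
    rw [← hmem, h', Submodule.mem_bot] at hε
    simpa using hε
  · rw [eq_top_iff]
    intro ε _
    rw [← hmem, h']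
    trivial

/-- A subalgebra which contains the stabilizer of a spinor line and five operators which move it
contains all generators. -/
theorem Gam_mem_of_generators {S : Subalgebra ℝ Cl}
    (h : ∀ l ∈ ([[1, 2, 3, 4], [1, 2, 5, 6], [1, 2, 7, 8], [0, 1, 3, 5, 7, 9], [0, 9],
      [0, 1, 2, 3, 4, 5, 6, 7, 8, 9, 10], [3], [5], [7], [1, 2], [0, 10, 1, 2]] :
      List (List (Fin 11))), mono l ∈ S) (i : Fin 11) : mono [i] ∈ S := by
  simp only [List.mem_cons, List.not_mem_nil, or_false, forall_eq_or_imp, forall_eq] at h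
  obtain ⟨hA, hB, hC, hP, hK, hO, h3, h5, h7, h12, hX⟩ := h
  -- Up to sign, products add supports modulo 2. The eleven given supports form a basis of `𝔽₂¹¹`,
  -- and the following lines solve for the unit vectors.
  have h34 := mono_mem_of_mul [3, 4] hA h12 (by decide)
  have h56 := mono_mem_of_mul [5, 6] hB h12 (by decide)
  have h78 := mono_mem_of_mul [7, 8] hC h12 (by decide)
  have h4 := mono_mem_of_mul [4] h3 h34 (by decide)
  have h6 := mono_mem_of_mul [6] h5 h56 (by decide)
  have h8 := mono_mem_of_mul [8] h7 h78 (by decide)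
  have h010 := mono_mem_of_mul [0, 10] hX h12 (by decide)
  have h1357 := mono_mem_of_mul [1, 3, 5, 7] hP hK (by decide)
  have h135 := mono_mem_of_mul [1, 3, 5] h1357 h7 (by decide)
  have h13 := mono_mem_of_mul [1, 3] h135 h5 (by decide)
  have h1 := mono_mem_of_mul [1] h13 h3 (by decide)
  have h2 := mono_mem_of_mul [2] h1 h12 (by decide)
  have h5678 := mono_mem_of_mul [5, 6, 7, 8] h56 h78 (by decide)
  have h1to8 := mono_mem_of_mul [1, 2, 3, 4, 5, 6, 7, 8] hA h5678 (by decide)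
  have h0910 := mono_mem_of_mul [0, 9, 10] hO h1to8 (by decide)
  have h10 := mono_mem_of_mul [10] h0910 hK (by decide)
  have h0 := mono_mem_of_mul [0] h010 h10 (by decide)
  have h9 := mono_mem_of_mul [9] h0 hK (by decide)
  fin_cases i <;> assumption

variable (Δ) in
-- Six commuting involutions, the last being the volume element, preserve a line. Doubling it with
-- five further monomials gives a nonzero subspace of dimension at most `2⁵` which all generators
-- preserve; by simplicity it is `Δ`.
theorem finrank_le_thirtytwo [IsSimpleModule Cl Δ] :
    FiniteDimensional ℝ Δ ∧ Module.finrank ℝ Δ ≤ 32 := by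
  have : Nontrivial Δ := IsSimpleModule.nontrivial Cl Δ
  obtain ⟨v, -, hv, hev⟩ := exists_joint_eigenvector (Δ := Δ)
    ([[1, 2, 3, 4], [1, 2, 5, 6], [1, 2, 7, 8], [0, 1, 3, 5, 7, 9], [0, 9],
      [0, 1, 2, 3, 4, 5, 6, 7, 8, 9, 10]].map mono)
    (by
      intro a ha
      obtain ⟨l, hl, rfl⟩ := List.mem_map.1 ha
      refine (mono_mul_mono [] ?_).trans mono_nil
      clear ha
      revert l
      decide)
    (by
      rw [List.pairwise_map]
      refine List.Pairwise.imp
        (R := fun l m : List (Fin 11) => normalForm (l ++ m) = normalForm (m ++ l))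
        (fun h => mono_commute h) ?_
      decide)
    ⊤ top_ne_bot (fun a _ ε _ => trivial)
  have h0 : ∀ l ∈ ([[1, 2, 3, 4], [1, 2, 5, 6], [1, 2, 7, 8], [0, 1, 3, 5, 7, 9], [0, 9],
      [0, 1, 2, 3, 4, 5, 6, 7, 8, 9, 10]] : List (List (Fin 11))),
      mono l ∈ stabilizer (Submodule.span ℝ {v}) := by
    intro l hl ε hε
    obtain ⟨c, hc⟩ := hev _ (List.mem_map_of_mem hl)
    obtain ⟨r, rfl⟩ := Submodule.mem_span_singleton.1 hε
    rw [smul_comm, hc]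
    exact Submodule.smul_mem _ _ (Submodule.smul_mem _ _ (Submodule.mem_span_singleton_self v))
  set W0 := Submodule.span ℝ {v}
  set W1 := double W0 (mono [3]) with hW1
  set W2 := double W1 (mono [5]) with hW2
  set W3 := double W2 (mono [7]) with hW3
  set W4 := double W3 (mono [1, 2]) with hW4
  set W5 := double W4 (mono [0, 10, 1, 2]) with hW5
  have f0 : Module.finrank ℝ W0 = 1 := finrank_span_singleton hv
  obtain ⟨_, f1⟩ := finrank_double_le W0 (mono [3])
  obtain ⟨_, f2⟩ := finrank_double_le W1 (mono [5])
  obtain ⟨_, f3⟩ := finrank_double_le W2 (mono [7])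
  obtain ⟨_, f4⟩ := finrank_double_le W3 (mono [1, 2])
  obtain ⟨_, f5⟩ := finrank_double_le W4 (mono [0, 10, 1, 2])
  have hle : W0 ≤ W5 := (le_double _ _).trans <| (le_double _ _).trans <| (le_double _ _).trans <|
    (le_double _ _).trans (le_double _ _)
  have hvW : v ∈ W5 := hle (Submodule.mem_span_singleton_self v)
  have htop : W5 = ⊤ := by
    refine eq_top_of_stabilizer_eq_top (fun h => hv ?_)
      (stabilizer_eq_top_of_Gam (Gam_mem_of_generators ?_))
    · rwa [h, Submodule.mem_bot] at hvW
    · have key (l : List (Fin 11))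
          (h : ((((mono l ∈ stabilizer W0 ∨ l = [3]) ∨ l = [5]) ∨ l = [7]) ∨ l = [1, 2]) ∨ l = [0, 10, 1, 2]) : mono l ∈ stabilizer W5 :=
        mono_mem_stabilizer_double _ _ <| h.imp_left fun h =>
        mono_mem_stabilizer_double _ _ <| h.imp_left fun h =>
        mono_mem_stabilizer_double _ _ <| h.imp_left fun h =>
        mono_mem_stabilizer_double _ _ <| h.imp_left fun h =>
        mono_mem_stabilizer_double _ _ h
      simp only [List.mem_cons, List.not_mem_nil, or_false, forall_eq_or_imp, forall_eq] at h0 ⊢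
      simp [key, h0]
  have hfin : FiniteDimensional ℝ W5 := inferInstance
  rw [htop] at hfin
  refine ⟨Module.Finite.equiv (Submodule.topEquiv (R := ℝ) (M := Δ)), ?_⟩
  rw [← finrank_top ℝ Δ, ← htop]
  rw [← hW1] at f1
  rw [← hW2] at f2
  rw [← hW3] at f3
  rw [← hW4] at f4
  rw [← hW5] at f5
  omega

end Spinors

/-! ### Rotations and the brane -/

theorem quantize_brane_eq_mono : quantize brane = mono [0, 1, 3, 5, 7, 9] := by
  rw [quantize_brane]
  rfl

theorem halfRot_eq (j k : Fin 11) (t : ℝ) :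
    halfRot j k t = algebraMap ℝ Cl (Real.cos (t / 2)) + Real.sin (t / 2) • mono [j, k] := by
  simp [halfRot, mono]

theorem Nhat_eq_mono (α β : ℝ) : Nhat α β = α • mono [0, 10] + β • mono [9, 10] := by
  simp [Nhat, mono]

theorem commute_halfRot {a : Cl} {j k : Fin 11} (h : Commute a (mono [j, k])) (t : ℝ) :
    Commute a (halfRot j k t) := by
  rw [halfRot_eq]
  exact (Algebra.commute_algebraMap_right _ a).add_right (h.smul_right _)

theorem commute_Rhat {a : Cl} (h12 : Commute a (mono [1, 2])) (h34 : Commute a (mono [3, 4]))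
    (h56 : Commute a (mono [5, 6])) (h78 : Commute a (mono [7, 8])) (θ : Fin 4 → ℝ) :
    Commute a (Rhat θ) :=
  (((commute_halfRot h12 _).mul_right (commute_halfRot h34 _)).mul_right
    (commute_halfRot h56 _)).mul_right (commute_halfRot h78 _)

theorem commute_mono_Rhat {l : List (Fin 11)}
    (h : ∀ m ∈ ([[1, 2], [3, 4], [5, 6], [7, 8]] : List (List (Fin 11))),
      normalForm (l ++ m) = normalForm (m ++ l)) (θ : Fin 4 → ℝ) :
    Commute (mono l) (Rhat θ) :=
  commute_Rhat (mono_commute (h _ (by simp))) (mono_commute (h _ (by simp)))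
    (mono_commute (h _ (by simp))) (mono_commute (h _ (by simp))) θ

theorem commute_mono_Nhat {l : List (Fin 11)}
    (h : ∀ m ∈ ([[0, 10], [9, 10]] : List (List (Fin 11))),
      normalForm (l ++ m) = normalForm (m ++ l)) (α β : ℝ) :
    Commute (mono l) (Nhat α β) := by
  rw [Nhat_eq_mono]
  exact ((mono_commute (h _ (by simp))).smul_right _).add_right
    ((mono_commute (h _ (by simp))).smul_right _)

theorem commute_Nhat_Rhat (α β : ℝ) (θ : Fin 4 → ℝ) : Commute (Nhat α β) (Rhat θ) :=
  commute_Rhat (commute_mono_Nhat (by decide) α β).symm (commute_mono_Nhat (by decide) α β).symm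
    (commute_mono_Nhat (by decide) α β).symm (commute_mono_Nhat (by decide) α β).symm θ

/-! ### Lifts inverted by conjugation with the brane -/

/-- `g'` is a right inverse of `g`, and the brane turns it into `g`. -/
structure IsReversed (g g' : Cl) : Prop where
  mul_eq_one : g * g' = 1
  brane_mul : quantize brane * g' = g * quantize brane

theorem IsReversed.mul {g g' h h' : Cl} (hg : IsReversed g g') (hh : IsReversed h h')
    (hc : Commute g h) : IsReversed (g * h) (h' * g') where
  mul_eq_one := by
    rw [mul_assoc, ← mul_assoc h, hh.mul_eq_one, one_mul, hg.mul_eq_one]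
  brane_mul := by
    rw [← mul_assoc, hh.brane_mul, mul_assoc, hg.brane_mul, ← mul_assoc, hc.eq]

/-- Passing the brane changes the sign of `a`, and so exchanges `p + q a` with its inverse `p - q
a`. -/
theorem isReversed_add_smul {a : Cl} (ha : quantize brane * a = -(a * quantize brane)) {c p q : ℝ}
    (hc : a * a = algebraMap ℝ Cl c) (hpq : p ^ 2 - q ^ 2 * c = 1) :
    IsReversed (algebraMap ℝ Cl p + q • a) (algebraMap ℝ Cl p - q • a) where
  mul_eq_one := by
    have : (algebraMap ℝ Cl p + q • a) * (algebraMap ℝ Cl p - q • a)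
        = (p ^ 2) • (1 : Cl) - (q ^ 2) • (a * a) := by
      simp only [Algebra.algebraMap_eq_smul_one, add_mul, mul_sub, smul_mul_assoc, mul_smul_comm,
        one_mul, mul_one]
      module
    rw [this, hc, Algebra.algebraMap_eq_smul_one, smul_smul, ← sub_smul, hpq, one_smul]
  brane_mul := by
    rw [mul_sub, add_mul, mul_smul_comm, ha, smul_neg, sub_neg_eq_add, smul_mul_assoc,
      Algebra.commutes]

theorem isReversed_halfRot {j k : Fin 11}
    (h : quantize brane * mono [j, k] = -(mono [j, k] * quantize brane))
    (hsq : mono [j, k] * mono [j, k] = -1) (t : ℝ) :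
    ∃ g', IsReversed (halfRot j k t) g' := by
  rw [halfRot_eq]
  exact ⟨_, isReversed_add_smul h (c := -1) (by rw [hsq, map_neg, map_one]) (by simp)⟩

theorem exists_isReversed_Rhat (θ : Fin 4 → ℝ) : ∃ g', IsReversed (Rhat θ) g' := by
  have hr (j k : Fin 11)
      (h : normalForm ([0, 1, 3, 5, 7, 9] ++ [j, k]) =
        (!(normalForm ([j, k] ++ [0, 1, 3, 5, 7, 9])).1,
          (normalForm ([j, k] ++ [0, 1, 3, 5, 7, 9])).2))
      (h2 : normalForm ([j, k] ++ [j, k]) = (true, [])) (t : ℝ) :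
      ∃ g', IsReversed (halfRot j k t) g' := by
    apply isReversed_halfRot
    · rw [quantize_brane_eq_mono]
      exact mono_anticommute h
    · rw [mono_mul_mono_neg [] h2, mono_nil]
  have hc (j k j' k' : Fin 11) (h : normalForm ([j, k] ++ [j', k']) =
      normalForm ([j', k'] ++ [j, k])) (t t' : ℝ) : Commute (halfRot j k t) (halfRot j' k' t') :=
    commute_halfRot (commute_halfRot (mono_commute h).symm t).symm t'
  obtain ⟨_, h1⟩ := hr 1 2 (by decide) (by decide) (θ 0)
  obtain ⟨_, h2⟩ := hr 3 4 (by decide) (by decide) (θ 1)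
  obtain ⟨_, h3⟩ := hr 5 6 (by decide) (by decide) (θ 2)
  obtain ⟨_, h4⟩ := hr 7 8 (by decide) (by decide) (θ 3)
  have c12 := hc 1 2 3 4 (by decide) (θ 0) (θ 1)
  have c13 := hc 1 2 5 6 (by decide) (θ 0) (θ 2)
  have c14 := hc 1 2 7 8 (by decide) (θ 0) (θ 3)
  have c23 := hc 3 4 5 6 (by decide) (θ 1) (θ 2)
  have c24 := hc 3 4 7 8 (by decide) (θ 1) (θ 3)
  have c34 := hc 5 6 7 8 (by decide) (θ 2) (θ 3)
  exact ⟨_, ((h1.mul h2 c12).mul h3 (c13.mul_left c23)).mul h4 ((c14.mul_left c24).mul_left c34)⟩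

theorem brane_mul_Nhat (α β : ℝ) : quantize brane * Nhat α β = -(Nhat α β * quantize brane) := by
  rw [quantize_brane_eq_mono, Nhat_eq_mono, mul_add, add_mul, mul_smul_comm, mul_smul_comm,
    mono_anticommute (l := [0, 1, 3, 5, 7, 9]) (m := [0, 10]) (by decide),
    mono_anticommute (l := [0, 1, 3, 5, 7, 9]) (m := [9, 10]) (by decide)]
  simp only [smul_neg, smul_mul_assoc, neg_add]

section Spinors

variable {Δ : Type*} [AddCommGroup Δ] [Module ℝ Δ] [Module Cl Δ] [IsScalarTower ℝ Cl Δ]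

/-- The transformed brane is `g π g' = g² π`, and `π` drops out on spinors which it fixes. -/
theorem mem_susySpace₂_iff {g g' : Cl} (hr : IsReversed g g') {A : Matrix (Fin 11) (Fin 11) ℝ}
    (hg : ∀ x, g * ι minkQ x = ι minkQ (A.mulVec x) * g) (ε : Δ) :
    ε ∈ susySpace₂ Δ brane (transform A brane) ↔ quantize brane • ε = ε ∧ g ^ 2 • ε = ε := by
  have h : quantize (transform A brane) = g ^ 2 * quantize brane := by
    have h1 := congrArg (· * g') (quantize_transform_mul hr.mul_eq_one hg)
    simp only [mul_assoc, hr.mul_eq_one, mul_one, hr.brane_mul] at h1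
    rw [h1, pow_two, mul_assoc]
  have h2 : ε ∈ susySpace₂ Δ brane (transform A brane) ↔
      quantize brane • ε = ε ∧ quantize (transform A brane) • ε = ε := Iff.rfl
  rw [h2, h, mul_smul]
  exact and_congr_right fun hε => by rw [hε]

theorem mem_susySpace₂_static (θ : Fin 4 → ℝ) (ε : Δ) :
    ε ∈ susySpace₂ Δ brane (transform (torusRot θ) brane) ↔
      quantize brane • ε = ε ∧ Rhat θ ^ 2 • ε = ε := by
  obtain ⟨g', h⟩ := exists_isReversed_Rhat θ
  exact mem_susySpace₂_iff h (Rhat_isSpinLift θ).2 ε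

/-! ### Sectors -/

/-- The sign `1` or `-1`. -/
def sgn (b : Bool) : ℝ := if b then 1 else -1

theorem sgn_mul_self (b : Bool) : sgn b * sgn b = 1 := by cases b <;> simp [sgn]

variable (Δ) in
/-- The spinors on which `Γ₃₄`, `Γ₅₆`, `Γ₇₈` act as `Γ₁₂` up to the given signs. -/
def sector (s : Bool × Bool × Bool) : Submodule ℝ Δ :=
  eigen Δ (mono [1, 2, 3, 4]) (-sgn s.1) ⊓ eigen Δ (mono [1, 2, 5, 6]) (-sgn s.2.1) ⊓
    eigen Δ (mono [1, 2, 7, 8]) (-sgn s.2.2)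

/-- The total angle of the rotation in a sector. -/
def angle (θ : Fin 4 → ℝ) (s : Bool × Bool × Bool) : ℝ :=
  θ 0 + sgn s.1 * θ 1 + sgn s.2.1 * θ 2 + sgn s.2.2 * θ 3

theorem mem_stabilizer_sector {a : Cl} (h1 : Commute a (mono [1, 2, 3, 4]))
    (h2 : Commute a (mono [1, 2, 5, 6])) (h3 : Commute a (mono [1, 2, 7, 8]))
    (s : Bool × Bool × Bool) : a ∈ stabilizer (sector Δ s) :=
  mem_stabilizer_inf (mem_stabilizer_inf (mem_stabilizer_eigen h1 _) (mem_stabilizer_eigen h2 _))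
    (mem_stabilizer_eigen h3 _)

/-- Since `Γ₁₂² = -1`, the eigenvalue `-s` of `Γ₁₂ Γ_{jk}` means that `Γ_{jk}` acts as `s Γ₁₂`. -/
theorem halfRot_smul_of_eigen {j k : Fin 11} (b : Bool) (t : ℝ) {ε : Δ}
    (hjk : mono [1, 2] * mono [1, 2, j, k] = -mono [j, k])
    (hε : ε ∈ eigen Δ (mono [1, 2, j, k]) (-sgn b)) :
    halfRot j k t • ε = halfRot 1 2 (sgn b * t) • ε := by
  have h : mono [j, k] • ε = sgn b • mono [1, 2] • ε := by
    rw [mem_eigen] at hε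
    rw [← neg_neg (mono [j, k]), ← hjk, neg_smul, mul_smul, hε, smul_comm, neg_smul, neg_neg]
  rw [halfRot_eq, halfRot_eq, add_smul, add_smul, smul_assoc, smul_assoc, h, smul_smul]
  cases b <;> simp [sgn, neg_div]

theorem halfRot_mul_halfRot (t t' : ℝ) :
    halfRot 1 2 t * halfRot 1 2 t' = halfRot 1 2 (t + t') := by
  have h : mono [1, 2] * mono [1, 2] = -1 := mono_mul_mono_neg [] (by decide)
  simp only [halfRot_eq, add_div, Real.cos_add, Real.sin_add, Algebra.algebraMap_eq_smul_one]
  simp only [add_mul, mul_add, smul_mul_assoc, mul_smul_comm, one_mul, mul_one, h]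
  module

/-- On a sector the four factors lie in the one-parameter group of `Γ₁₂`, so their angles add up.
Squaring cancels the half in `halfRot`. -/
theorem Rhat_sq_smul_of_mem_sector (θ : Fin 4 → ℝ) {s : Bool × Bool × Bool} {ε : Δ}
    (hε : ε ∈ sector Δ s) : Rhat θ ^ 2 • ε = halfRot 1 2 (2 * angle θ s) • ε := by
  have hR : ∀ η ∈ sector Δ s, Rhat θ • η = halfRot 1 2 (angle θ s) • η := by
    rintro η ⟨⟨h1, h2⟩, h3⟩
    have hc (j k : Fin 11) (h : normalForm ([j, k] ++ [1, 2]) = normalForm ([1, 2] ++ [j, k]))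
        (t t' : ℝ) : Commute (halfRot j k t) (halfRot 1 2 t') :=
      commute_halfRot (commute_halfRot (mono_commute h).symm t).symm t'
    rw [Rhat, mul_smul, mul_smul, mul_smul,
      halfRot_smul_of_eigen s.2.2 (θ 3) (mono_mul_mono_neg _ (by decide)) h3,
      ← mul_smul (halfRot 5 6 _), (hc 5 6 (by decide) _ _).eq, mul_smul,
      halfRot_smul_of_eigen s.2.1 (θ 2) (mono_mul_mono_neg _ (by decide)) h2,
      ← mul_smul (halfRot 1 2 _) (halfRot 1 2 _), halfRot_mul_halfRot,
      ← mul_smul (halfRot 3 4 _), (hc 3 4 (by decide) _ _).eq, mul_smul,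
      halfRot_smul_of_eigen s.1 (θ 1) (mono_mul_mono_neg _ (by decide)) h1,
      ← mul_smul, ← mul_smul, halfRot_mul_halfRot, halfRot_mul_halfRot]
    congr 2
    rw [angle]
    ring
  have hmem : Rhat θ ∈ stabilizer (sector Δ s) :=
    mem_stabilizer_sector (commute_mono_Rhat (by decide) θ).symm
      (commute_mono_Rhat (by decide) θ).symm (commute_mono_Rhat (by decide) θ).symm s
  rw [pow_two, mul_smul, hR _ (hmem _ hε), hR _ hε, ← mul_smul, halfRot_mul_halfRot, two_mul]

theorem halfRot_eigenvalue {x μ : ℝ} {ε : Δ} (h : halfRot 1 2 (2 * x) • ε = μ • ε) (hε : ε ≠ 0) :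
    Real.sin x = 0 ∧ Real.cos x = μ := by
  have hsq : mono [1, 2] • mono [1, 2] • ε = -ε := by
    rw [← mul_smul, mono_mul_mono_neg [] (by decide), mono_nil, neg_smul, one_smul]
  rw [halfRot_eq, mul_div_cancel_left₀ _ two_ne_zero, add_smul, algebraMap_smul, smul_assoc] at h
  have h' := congrArg (mono [1, 2] • ·) h
  simp only [smul_add, smul_comm (mono [1, 2]), hsq] at h'
  generalize mono [1, 2] • ε = η at h h'
  -- Apply the conjugate `cos x - μ - sin x Γ₁₂` to `(cos x - μ + sin x Γ₁₂) ε = 0`; the product is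
  -- a sum of two squares.
  have h3 : ((Real.cos x - μ) ^ 2 + Real.sin x ^ 2) • ε = 0 := by
    linear_combination (norm := module) (Real.cos x - μ) • h - Real.sin x • h'
  have h4 := (smul_eq_zero.1 h3).resolve_right hε
  constructor <;> nlinarith [sq_nonneg (Real.cos x - μ), sq_nonneg (Real.sin x)]

/-- Stability under the three commuting involutions makes `V` the sum of its intersections with the
sectors. -/
theorem le_of_inf_sector_le {V W : Submodule ℝ Δ} (h1 : mono [1, 2, 3, 4] ∈ stabilizer V)
    (h2 : mono [1, 2, 5, 6] ∈ stabilizer V) (h3 : mono [1, 2, 7, 8] ∈ stabilizer V)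
    (h : ∀ s, V ⊓ sector Δ s ≤ W) : V ≤ W := by
  have hsq (l : List (Fin 11)) (hl : normalForm (l ++ l) = (false, [])) : mono l * mono l = 1 :=
    mono_mul_mono [] hl
  have c12 : Commute (mono [1, 2, 5, 6]) (mono [1, 2, 3, 4]) := mono_commute (by decide)
  have c13 : Commute (mono [1, 2, 7, 8]) (mono [1, 2, 3, 4]) := mono_commute (by decide)
  have c23 : Commute (mono [1, 2, 7, 8]) (mono [1, 2, 5, 6]) := mono_commute (by decide)
  have h' (a b c : Bool) : V ⊓ eigen Δ (mono [1, 2, 3, 4]) (-sgn a) ⊓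
      eigen Δ (mono [1, 2, 5, 6]) (-sgn b) ⊓ eigen Δ (mono [1, 2, 7, 8]) (-sgn c) ≤ W := by
    rw [inf_assoc, inf_assoc, ← inf_assoc (eigen Δ (mono [1, 2, 3, 4]) _)]
    exact h (a, b, c)
  have split {U : Submodule ℝ Δ} {a : Cl} (ha : a * a = 1) (hU : a ∈ stabilizer U)
      (hle : ∀ b, U ⊓ eigen Δ a (-sgn b) ≤ W) : U ≤ W := by
    rw [← sup_eigen_eq ha hU]
    refine sup_le ?_ ?_
    · simpa [sgn] using hle false
    · simpa [sgn] using hle true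
  refine split (hsq _ (by decide)) h1 fun a => ?_
  refine split (hsq _ (by decide)) (mem_stabilizer_inf h2 (mem_stabilizer_eigen c12 _)) fun b => ?_
  exact split (hsq _ (by decide)) (mem_stabilizer_inf (mem_stabilizer_inf h3
    (mem_stabilizer_eigen c13 _)) (mem_stabilizer_eigen c23 _)) fun c => h' a b c

/-! ### Boosts -/

theorem eigen_Rhat_sq_eq_bot (θ : Fin 4 → ℝ) {μ : ℝ} (hμ : 0 < μ) (hμ1 : μ ≠ 1) :
    eigen Δ (Rhat θ ^ 2) μ = ⊥ := by
  rw [eq_bot_iff]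
  have hst (l : List (Fin 11)) (h : ∀ m ∈ ([[1, 2], [3, 4], [5, 6], [7, 8]] : List (List (Fin 11))),
      normalForm (l ++ m) = normalForm (m ++ l)) :
      mono l ∈ stabilizer (eigen Δ (Rhat θ ^ 2) μ) :=
    mem_stabilizer_eigen ((commute_mono_Rhat h θ).pow_right 2) _
  refine le_of_inf_sector_le (hst _ (by decide)) (hst _ (by decide)) (hst _ (by decide)) ?_
  rintro s ε ⟨h1, h2⟩
  rw [SetLike.mem_coe, mem_eigen, Rhat_sq_smul_of_mem_sector θ h2] at h1
  by_contra hne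
  obtain ⟨hs, hc⟩ := halfRot_eigenvalue h1 hne
  have := Real.sin_sq_add_cos_sq (angle θ s)
  rw [hs, hc] at this
  exact hμ1 (by nlinarith)

/-- `N̂ / r` is an involution commuting with `R̂`. On its eigenspace for `c = ±1` the squared boost
is `exp (c r)`, so a fixed spinor would have `R̂²`-eigenvalue `exp (-c r)`, which is positive and
different from 1. -/
theorem susySpace₂_boost_eq_bot (θ : Fin 4 → ℝ) {α β : ℝ} (h : β ^ 2 < α ^ 2) :
    susySpace₂ Δ brane (transform (lorentzL θ α β) brane) = ⊥ := by
  obtain ⟨r, hr, hr2⟩ : ∃ r : ℝ, 0 < r ∧ r ^ 2 = α ^ 2 - β ^ 2 :=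
    ⟨Real.sqrt (α ^ 2 - β ^ 2), Real.sqrt_pos.2 (by linarith), Real.sq_sqrt (by linarith)⟩
  have hsq : Nhat α β * Nhat α β = algebraMap ℝ Cl (r ^ 2) := by rw [Nhat_sq, hr2]
  have hcN : Commute (Rhat θ) (boostLift α β r) := by
    rw [boostLift]
    exact (Algebra.commute_algebraMap_right _ _).add_right
      ((commute_Nhat_Rhat α β θ).symm.smul_right _)
  obtain ⟨R', hR⟩ := exists_isReversed_Rhat θ
  have hB : IsReversed (boostLift α β r) _ := isReversed_add_smul (brane_mul_Nhat α β) hsq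
    (p := Real.cosh (r / 2)) (q := Real.sinh (r / 2) / r)
    (by field_simp; exact Real.cosh_sq_sub_sinh_sq _)
  have hlift : ∀ x, Rhat θ * boostLift α β r * ι minkQ x =
      ι minkQ ((lorentzL θ α β).mulVec x) * (Rhat θ * boostLift α β r) := by
    intro x
    rw [mul_assoc, boostLift_mul_iota hr.ne' hr2, ← mul_assoc, (Rhat_isSpinLift θ).2, mul_assoc,
      lorentzL, Matrix.mulVec_mulVec]
  have hκ : (r⁻¹ • Nhat α β) * (r⁻¹ • Nhat α β) = 1 := by
    rw [smul_mul_smul_comm, hsq, Algebra.algebraMap_eq_smul_one, smul_smul]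
    field_simp
    simp
  have key : eigen Δ ((Rhat θ * boostLift α β r) ^ 2) 1 ≤ ⊥ := by
    have hsplit (c : ℝ) (hc : c = 1 ∨ c = -1) : eigen Δ ((Rhat θ * boostLift α β r) ^ 2) 1 ⊓
        eigen Δ (r⁻¹ • Nhat α β) c ≤ ⊥ := by
      rintro ε ⟨h1, h2⟩
      rw [SetLike.mem_coe, mem_eigen] at h1 h2
      have h3 : boostLift α β r • ε = Real.exp (c * r / 2) • ε := by
        have : Nhat α β • ε = (r * c) • ε := by
          rw [smul_assoc, inv_smul_eq_iff₀ hr.ne'] at h2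
          rw [h2, smul_smul]
        rw [boostLift, add_smul, algebraMap_smul, smul_assoc, this, smul_smul, ← add_smul]
        congr 1
        field_simp
        rcases hc with rfl | rfl
        · rw [mul_one, mul_one, Real.cosh_add_sinh]
        · rw [mul_neg, mul_one, ← sub_eq_add_neg, Real.cosh_sub_sinh]; ring_nf
      have h4 : Rhat θ ^ 2 • ε = Real.exp (-(c * r)) • ε := by
        rw [hcN.mul_pow, pow_two (boostLift α β r), mul_smul, mul_smul, h3,
          smul_comm (boostLift α β r), h3, smul_smul, ← Real.exp_add, add_halves,
          smul_comm (Rhat θ ^ 2), one_smul] at h1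
        nth_rewrite 2 [← h1]
        rw [smul_smul, ← Real.exp_add, neg_add_cancel, Real.exp_zero, one_smul]
      have h5 := eigen_Rhat_sq_eq_bot (Δ := Δ) θ (Real.exp_pos (-(c * r)))
        (by
          rw [Ne, Real.exp_eq_one_iff]
          rcases hc with rfl | rfl <;> simp [hr.ne'])
      rw [← h5]
      exact h4
    have hstab : r⁻¹ • Nhat α β ∈ stabilizer (eigen Δ ((Rhat θ * boostLift α β r) ^ 2) 1) := by
      refine mem_stabilizer_eigen (Commute.pow_right ?_ 2) _
      refine (((commute_Nhat_Rhat α β θ)).mul_right ?_).smul_left _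
      rw [boostLift]
      exact (Algebra.commute_algebraMap_right _ _).add_right ((Commute.refl _).smul_right _)
    rw [← sup_eigen_eq hκ hstab]
    exact sup_le (hsplit 1 (Or.inl rfl)) (hsplit (-1) (Or.inr rfl))
  rw [eq_bot_iff]
  intro ε hε
  rw [mem_susySpace₂_iff (hR.mul hB hcN) hlift] at hε
  exact key (by rw [mem_eigen, one_smul]; exact hε.2)

/-! ### Null rotations -/

/-- Applying `N̂` to the equation shows that `R̂²` fixes `N̂ ε`. In each sector, either `N̂ η = 0`
and `R̂² η = η` at once, or `N̂ η` is a nonzero fixed spinor of the same sector, which makes `R̂²`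
trivial there. So `R̂² ε = ε`, and subtraction leaves `N̂ ε = 0`. -/
theorem Rhat_sq_mul_one_add_Nhat_smul_iff (θ : Fin 4 → ℝ) {α β : ℝ} (h : α ^ 2 = β ^ 2) (ε : Δ) :
    (Rhat θ ^ 2 * (1 + Nhat α β)) • ε = ε ↔ Rhat θ ^ 2 • ε = ε ∧ Nhat α β • ε = 0 := by
  have hN : Nhat α β * Nhat α β = 0 := by rw [Nhat_sq, h, sub_self, map_zero]
  have hc : Commute (Nhat α β) (Rhat θ ^ 2) := (commute_Nhat_Rhat α β θ).pow_right 2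
  have hfix : ∀ ε : Δ, (Rhat θ ^ 2 * (1 + Nhat α β)) • ε = ε →
      Rhat θ ^ 2 • Nhat α β • ε = Nhat α β • ε := by
    intro ε hε
    have h1 := congrArg (Nhat α β • ·) hε
    simp only [← mul_smul] at h1
    rw [← mul_assoc, hc.eq, mul_assoc, mul_add, hN, add_zero, mul_one] at h1
    rw [← mul_smul, h1]
  constructor
  · intro hε
    have hle : eigen Δ (Rhat θ ^ 2 * (1 + Nhat α β)) 1 ≤ eigen Δ (Rhat θ ^ 2) 1 := by
      have hst (l : List (Fin 11))
          (h : ∀ m ∈ ([[1, 2], [3, 4], [5, 6], [7, 8]] : List (List (Fin 11))),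
            normalForm (l ++ m) = normalForm (m ++ l))
          (h' : ∀ m ∈ ([[0, 10], [9, 10]] : List (List (Fin 11))),
            normalForm (l ++ m) = normalForm (m ++ l)) :
          mono l ∈ stabilizer (eigen Δ (Rhat θ ^ 2 * (1 + Nhat α β)) 1) :=
        mem_stabilizer_eigen (((commute_mono_Rhat h θ).pow_right 2).mul_right
          ((Commute.one_right _).add_right (commute_mono_Nhat h' α β))) _
      refine le_of_inf_sector_le (hst _ (by decide) (by decide)) (hst _ (by decide) (by decide))
        (hst _ (by decide) (by decide)) ?_
      rintro s η ⟨h1, h2⟩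
      rw [SetLike.mem_coe, mem_eigen, one_smul] at h1
      have h3 := hfix η h1
      rw [mem_eigen, one_smul]
      by_cases hz : Nhat α β • η = 0
      · rwa [mul_smul, add_smul, one_smul, hz, add_zero] at h1
      · have hmem : Nhat α β • η ∈ sector Δ s :=
          mem_stabilizer_sector (commute_mono_Nhat (by decide) α β).symm
            (commute_mono_Nhat (by decide) α β).symm (commute_mono_Nhat (by decide) α β).symm s _ h2
        rw [Rhat_sq_smul_of_mem_sector θ hmem, ← one_smul ℝ (Nhat α β • η),
          smul_comm (halfRot _ _ _)] at h3
        obtain ⟨hs, hcos⟩ := halfRot_eigenvalue (μ := 1) (by simpa using h3) hz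
        rw [Rhat_sq_smul_of_mem_sector θ h2, halfRot_eq, mul_div_cancel_left₀ _ two_ne_zero, hs,
          hcos]
        simp
    have h1 : Rhat θ ^ 2 • ε = ε := by
      have := hle (show ε ∈ eigen Δ (Rhat θ ^ 2 * (1 + Nhat α β)) 1 by rwa [mem_eigen, one_smul])
      rwa [mem_eigen, one_smul] at this
    refine ⟨h1, ?_⟩
    have h2 := hfix ε hε
    rw [mul_smul, add_smul, one_smul, smul_add, h1, h2] at hε
    simpa using hε
  · rintro ⟨h1, h2⟩
    rw [mul_smul, add_smul, one_smul, h2, add_zero, h1]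

theorem mem_susySpace₂_null (θ : Fin 4 → ℝ) {α β : ℝ} (h : α ^ 2 = β ^ 2) (ε : Δ) :
    ε ∈ susySpace₂ Δ brane (transform (lorentzL θ α β) brane) ↔
      quantize brane • ε = ε ∧ Rhat θ ^ 2 • ε = ε ∧ Nhat α β • ε = 0 := by
  have hsq : Nhat α β * Nhat α β = algebraMap ℝ Cl 0 := by rw [Nhat_sq, h, sub_self]
  obtain ⟨R', hR⟩ := exists_isReversed_Rhat θ
  have hS := isReversed_add_smul (brane_mul_Nhat α β) hsq (p := 1) (q := 1 / 2) (by norm_num)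
  rw [map_one] at hS
  have hc : Commute (Rhat θ) (1 + (1 / 2 : ℝ) • Nhat α β) :=
    (Commute.one_right _).add_right ((commute_Nhat_Rhat α β θ).symm.smul_right _)
  have hlift := (Rhat_isSpinLift θ).mul (one_add_Nhat_isSpinLift h)
  have hpow : (1 + (1 / 2 : ℝ) • Nhat α β) ^ 2 = 1 + Nhat α β := by
    rw [pow_two, add_mul, mul_add, one_mul, one_mul, smul_mul_assoc, mul_add, mul_smul_comm, hsq,
      map_zero]
    simp only [mul_one, smul_zero, add_zero]
    module
  rw [lorentzL, mem_susySpace₂_iff (hR.mul hS hc) hlift.2, hc.mul_pow, hpow,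
    Rhat_sq_mul_one_add_Nhat_smul_iff θ h]

end Spinors

section Spinors

variable {Δ : Type*} [AddCommGroup Δ] [Module ℝ Δ] [Module Cl Δ] [IsScalarTower ℝ Cl Δ]

/-! ### Dimensions -/

theorem finrank_eq_sum_sector [FiniteDimensional ℝ Δ] {V : Submodule ℝ Δ}
    (h1 : mono [1, 2, 3, 4] ∈ stabilizer V) (h2 : mono [1, 2, 5, 6] ∈ stabilizer V)
    (h3 : mono [1, 2, 7, 8] ∈ stabilizer V) :
    Module.finrank ℝ V = ∑ s, Module.finrank ℝ ↥(V ⊓ sector Δ s) := by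
  have hsq (l : List (Fin 11)) (hl : normalForm (l ++ l) = (false, [])) : mono l * mono l = 1 :=
    mono_mul_mono [] hl
  have c12 : Commute (mono [1, 2, 5, 6]) (mono [1, 2, 3, 4]) := mono_commute (by decide)
  have c13 : Commute (mono [1, 2, 7, 8]) (mono [1, 2, 3, 4]) := mono_commute (by decide)
  have c23 : Commute (mono [1, 2, 7, 8]) (mono [1, 2, 5, 6]) := mono_commute (by decide)
  have split {U : Submodule ℝ Δ} {a : Cl} (ha : a * a = 1) (hU : a ∈ stabilizer U) :
      Module.finrank ℝ U = ∑ b, Module.finrank ℝ ↥(U ⊓ eigen Δ a (-sgn b)) := by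
    rw [← finrank_add_finrank_eigen ha hU, Fintype.sum_bool, add_comm,
      show -sgn true = -1 by simp [sgn], show -sgn false = 1 by simp [sgn]]
  rw [Fintype.sum_prod_type, split (hsq _ (by decide)) h1]
  refine Finset.sum_congr rfl fun a _ => ?_
  rw [Fintype.sum_prod_type, split (hsq _ (by decide))
    (mem_stabilizer_inf h2 (mem_stabilizer_eigen c12 _))]
  refine Finset.sum_congr rfl fun b _ => ?_
  rw [split (hsq _ (by decide)) (mem_stabilizer_inf (mem_stabilizer_inf h3
    (mem_stabilizer_eigen c13 _)) (mem_stabilizer_eigen c23 _))]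
  refine Finset.sum_congr rfl fun c _ => ?_
  rw [inf_assoc, inf_assoc, ← inf_assoc (eigen Δ (mono [1, 2, 3, 4]) _)]
  rfl

theorem neg_sgn_eq_or (b : Bool) : -sgn b = 1 ∨ -sgn b = -1 := by cases b <;> simp [sgn]

/-- Five commuting involutions halve the space in turn: for each, some monomial anticommutes with it
and commutes with the earlier ones. For `Γ₀₉` this is `Γ₀♮ Γ₁₂`, as `Γ₀♮` alone would anticommute
with the brane. -/
theorem finrank_eq_thirtytwo_mul [FiniteDimensional ℝ Δ] (s : Bool × Bool × Bool) {σ : ℝ}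
    (hσ : σ = 1 ∨ σ = -1) :
    Module.finrank ℝ Δ = 32 * Module.finrank ℝ
      ↥(sector Δ s ⊓ eigen Δ (mono [0, 1, 3, 5, 7, 9]) 1 ⊓ eigen Δ (mono [0, 9]) σ) := by
  have hsq (l : List (Fin 11)) (hl : normalForm (l ++ l) = (false, [])) : mono l * mono l = 1 :=
    mono_mul_mono [] hl
  have hst {l m : List (Fin 11)} (h : normalForm (l ++ m) = normalForm (m ++ l)) (c : ℝ) :
      mono l ∈ stabilizer (eigen Δ (mono m) c) := mem_stabilizer_eigen (mono_commute h) c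
  have g1 := two_mul_finrank_inf_eigen (hsq [1, 2, 3, 4] (by decide)) (isUnit_mono [3])
    (mono_anticommute (by decide)) (V := (⊤ : Submodule ℝ Δ)) (fun _ _ => trivial)
    (fun _ _ => trivial) (neg_sgn_eq_or s.1)
  rw [top_inf_eq, finrank_top] at g1
  have g2 := two_mul_finrank_inf_eigen (hsq [1, 2, 5, 6] (by decide)) (isUnit_mono [5])
    (mono_anticommute (by decide)) (hst (m := [1, 2, 3, 4]) (by decide) (-sgn s.1))
    (hst (by decide) _) (neg_sgn_eq_or s.2.1)
  have g3 := two_mul_finrank_inf_eigen (hsq [1, 2, 7, 8] (by decide)) (isUnit_mono [7])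
    (mono_anticommute (by decide)) (mem_stabilizer_inf
      (hst (m := [1, 2, 3, 4]) (by decide) (-sgn s.1))
      (hst (m := [1, 2, 5, 6]) (by decide) (-sgn s.2.1)))
    (mem_stabilizer_inf (hst (by decide) _) (hst (by decide) _)) (neg_sgn_eq_or s.2.2)
  have hsec {l : List (Fin 11)} (h : ∀ m ∈ ([[1, 2, 3, 4], [1, 2, 5, 6], [1, 2, 7, 8]] :
      List (List (Fin 11))), normalForm (l ++ m) = normalForm (m ++ l)) :
      mono l ∈ stabilizer (sector Δ s) :=
    mem_stabilizer_sector (mono_commute (h _ (by simp))) (mono_commute (h _ (by simp)))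
      (mono_commute (h _ (by simp))) s
  have g4 := two_mul_finrank_inf_eigen (hsq [0, 1, 3, 5, 7, 9] (by decide)) (isUnit_mono [1, 2])
    (mono_anticommute (by decide)) (hsec (by decide)) (hsec (by decide))
    (Or.inl rfl : (1 : ℝ) = 1 ∨ _)
  have g5 := two_mul_finrank_inf_eigen (hsq [0, 9] (by decide)) (isUnit_mono [0, 10, 1, 2])
    (mono_anticommute (by decide)) (mem_stabilizer_inf (hsec (by decide))
      (hst (m := [0, 1, 3, 5, 7, 9]) (by decide) 1))
    (mem_stabilizer_inf (hsec (by decide)) (hst (by decide) 1)) hσ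
  change 2 * Module.finrank ℝ ↥(sector Δ s) = _ at g3
  omega

variable (Δ) in
theorem finrank_spinors [IsSimpleModule Cl Δ] : Module.finrank ℝ Δ = 32 := by
  obtain ⟨_, hle⟩ := finrank_le_thirtytwo Δ
  have : Nontrivial Δ := IsSimpleModule.nontrivial Cl Δ
  have hpos : 0 < Module.finrank ℝ Δ := Module.finrank_pos
  have h := finrank_eq_thirtytwo_mul (Δ := Δ) (true, true, true) (σ := 1) (Or.inl rfl)
  omega

theorem finrank_joint_eigenspace [IsSimpleModule Cl Δ] (s : Bool × Bool × Bool) {σ : ℝ}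
    (hσ : σ = 1 ∨ σ = -1) : Module.finrank ℝ
      ↥(sector Δ s ⊓ eigen Δ (mono [0, 1, 3, 5, 7, 9]) 1 ⊓ eigen Δ (mono [0, 9]) σ) = 1 := by
  obtain ⟨_, -⟩ := finrank_le_thirtytwo Δ
  have h := finrank_eq_thirtytwo_mul (Δ := Δ) s hσ
  rw [finrank_spinors] at h
  omega

/-- `N̂ = α Γ₀♮ (1 - σ Γ₀₉)`, and `Γ₀♮` is invertible. -/
theorem eigen_Nhat_zero {α β σ : ℝ} (hσ : σ = 1 ∨ σ = -1) (hβ : β = σ * α) (hα : α ≠ 0) :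
    eigen Δ (Nhat α β) 0 = eigen Δ (mono [0, 9]) σ := by
  have hN : Nhat α β = α • (mono [0, 10] * (1 - σ • mono [0, 9])) := by
    have h : mono [0, 10] * mono [0, 9] = -mono [9, 10] := mono_mul_mono_neg _ (by decide)
    rw [Nhat_eq_mono, mul_sub, mul_one, mul_smul_comm, h, hβ]
    module
  have hσ2 : σ * σ = 1 := by rcases hσ with rfl | rfl <;> norm_num
  ext ε
  rw [mem_eigen, mem_eigen, hN, smul_assoc, mul_smul, zero_smul, smul_eq_zero_iff_right hα,
    (isUnit_mono [0, 10]).smul_eq_zero, sub_smul, one_smul, smul_assoc, sub_eq_zero]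
  constructor
  · intro h
    nth_rewrite 2 [h]
    rw [smul_smul, hσ2, one_smul]
  · intro h
    rw [h, smul_smul, hσ2, one_smul]

theorem susySpace₂_static_eq (θ : Fin 4 → ℝ) :
    susySpace₂ Δ brane (transform (torusRot θ) brane) =
      eigen Δ (mono [0, 1, 3, 5, 7, 9]) 1 ⊓ eigen Δ (Rhat θ ^ 2) 1 := by
  ext ε
  rw [mem_susySpace₂_static, Submodule.mem_inf, mem_eigen, mem_eigen, one_smul,
    quantize_brane_eq_mono]

theorem susySpace₂_null_eq (θ : Fin 4 → ℝ) {α β σ : ℝ} (hσ : σ = 1 ∨ σ = -1) (hβ : β = σ * α)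
    (hα : α ≠ 0) : susySpace₂ Δ brane (transform (lorentzL θ α β) brane) =
      eigen Δ (mono [0, 1, 3, 5, 7, 9]) 1 ⊓ eigen Δ (Rhat θ ^ 2) 1 ⊓ eigen Δ (mono [0, 9]) σ := by
  have h : α ^ 2 = β ^ 2 := by rw [hβ]; rcases hσ with rfl | rfl <;> ring
  ext ε
  rw [mem_susySpace₂_null θ h, ← eigen_Nhat_zero hσ hβ hα, Submodule.mem_inf, Submodule.mem_inf,
    mem_eigen, mem_eigen, mem_eigen, one_smul, zero_smul, quantize_brane_eq_mono, and_assoc]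

theorem exists_sign {α β : ℝ} (h : α ^ 2 = β ^ 2) : ∃ σ : ℝ, (σ = 1 ∨ σ = -1) ∧ β = σ * α := by
  rcases sq_eq_sq_iff_eq_or_eq_neg.1 h.symm with h | h
  · exact ⟨1, Or.inl rfl, by rw [h, one_mul]⟩
  · exact ⟨-1, Or.inr rfl, by rw [h, neg_one_mul]⟩

/-- `Γ₀♮ Γ₁₂` preserves the static solutions and exchanges the two eigenspaces of `Γ₀₉` in them. -/
theorem two_mul_finrank_null [IsSimpleModule Cl Δ] (θ : Fin 4 → ℝ) {α β : ℝ} (h : α ^ 2 = β ^ 2)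
    (hα : α ≠ 0) :
    2 * Module.finrank ℝ (susySpace₂ Δ brane (transform (lorentzL θ α β) brane)) =
      Module.finrank ℝ (susySpace₂ Δ brane (transform (torusRot θ) brane)) := by
  obtain ⟨_, -⟩ := finrank_le_thirtytwo Δ
  obtain ⟨σ, hσ, hβ⟩ := exists_sign h
  rw [susySpace₂_null_eq θ hσ hβ hα, susySpace₂_static_eq]
  have hst {l : List (Fin 11)}
      (h : ∀ m ∈ ([[0, 1, 3, 5, 7, 9], [1, 2], [3, 4], [5, 6], [7, 8]] : List (List (Fin 11))),
        normalForm (l ++ m) = normalForm (m ++ l)) : mono l ∈ stabilizer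
      (eigen Δ (mono [0, 1, 3, 5, 7, 9]) 1 ⊓ eigen Δ (Rhat θ ^ 2) 1) :=
    mem_stabilizer_inf (mem_stabilizer_eigen (mono_commute (h _ (by simp))) _)
      (mem_stabilizer_eigen ((commute_mono_Rhat (fun m hm => h m (List.mem_cons_of_mem _ hm))
        θ).pow_right 2) _)
  exact two_mul_finrank_inf_eigen (mono_mul_mono [] (by decide)) (isUnit_mono [0, 10, 1, 2])
    (mono_anticommute (by decide)) (hst (by decide)) (hst (by decide)) hσ

open Classical in
/-- The sectors in which the rotation is trivial. -/
def fixedSectors (θ : Fin 4 → ℝ) : Finset (Bool × Bool × Bool) :=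
  Finset.univ.filter fun s => Real.cos (angle θ s) = 1

theorem mem_fixedSectors {θ : Fin 4 → ℝ} {s : Bool × Bool × Bool} :
    s ∈ fixedSectors θ ↔ Real.cos (angle θ s) = 1 := by
  simp [fixedSectors]

theorem inf_eigen_Rhat_sq (θ : Fin 4 → ℝ) (s : Bool × Bool × Bool) (V : Submodule ℝ Δ) :
    V ⊓ eigen Δ (Rhat θ ^ 2) 1 ⊓ sector Δ s =
      if s ∈ fixedSectors θ then V ⊓ sector Δ s else ⊥ := by
  split_ifs with h
  · rw [mem_fixedSectors] at h
    have hs : Real.sin (angle θ s) = 0 := by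
      have := Real.sin_sq_add_cos_sq (angle θ s)
      rw [h] at this
      nlinarith
    refine le_antisymm (inf_le_inf_right _ inf_le_left) fun ε hε => ⟨⟨hε.1, ?_⟩, hε.2⟩
    rw [SetLike.mem_coe, mem_eigen, Rhat_sq_smul_of_mem_sector θ hε.2, halfRot_eq,
      mul_div_cancel_left₀ _ two_ne_zero, hs, h]
    simp
  · rw [eq_bot_iff]
    rintro ε ⟨⟨-, h1⟩, h2⟩
    rw [SetLike.mem_coe, mem_eigen, Rhat_sq_smul_of_mem_sector θ h2] at h1
    by_contra hne
    exact h (mem_fixedSectors.2 (halfRot_eigenvalue h1 hne).2)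

/-- Every sector contributes a line if its rotation is trivial, and nothing otherwise. -/
theorem finrank_null [IsSimpleModule Cl Δ] (θ : Fin 4 → ℝ) {α β : ℝ} (h : α ^ 2 = β ^ 2)
    (hα : α ≠ 0) :
    Module.finrank ℝ (susySpace₂ Δ brane (transform (lorentzL θ α β) brane)) =
      (fixedSectors θ).card := by
  obtain ⟨_, -⟩ := finrank_le_thirtytwo Δ
  obtain ⟨σ, hσ, hβ⟩ := exists_sign h
  rw [susySpace₂_null_eq θ hσ hβ hα, inf_right_comm]
  have hst {l : List (Fin 11)}
      (h : ∀ m ∈ ([[0, 1, 3, 5, 7, 9], [0, 9], [1, 2], [3, 4], [5, 6], [7, 8]] :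
        List (List (Fin 11))),
        normalForm (l ++ m) = normalForm (m ++ l)) : mono l ∈ stabilizer
      (eigen Δ (mono [0, 1, 3, 5, 7, 9]) 1 ⊓ eigen Δ (mono [0, 9]) σ ⊓ eigen Δ (Rhat θ ^ 2) 1) :=
    mem_stabilizer_inf (mem_stabilizer_inf
      (mem_stabilizer_eigen (mono_commute (h _ (by simp))) _)
      (mem_stabilizer_eigen (mono_commute (h _ (by simp))) _))
      (mem_stabilizer_eigen ((commute_mono_Rhat (fun m hm => h m (List.mem_cons_of_mem _
        (List.mem_cons_of_mem _ hm))) θ).pow_right 2) _)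
  rw [finrank_eq_sum_sector (hst (by decide)) (hst (by decide)) (hst (by decide))]
  have hs (s : Bool × Bool × Bool) : Module.finrank ℝ ↥(eigen Δ (mono [0, 1, 3, 5, 7, 9]) 1 ⊓
      eigen Δ (mono [0, 9]) σ ⊓ eigen Δ (Rhat θ ^ 2) 1 ⊓ sector Δ s) =
      if s ∈ fixedSectors θ then 1 else 0 := by
    rw [inf_eigen_Rhat_sq]
    by_cases hs : s ∈ fixedSectors θ
    · rw [if_pos hs, if_pos hs, inf_comm, ← inf_assoc, finrank_joint_eigenspace s hσ]
    · rw [if_neg hs, if_neg hs, finrank_bot]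
  rw [Finset.sum_congr rfl fun s _ => hs s]
  simp

end Spinors

/-! ### The codimension of the intersection -/

/-- The span of the frame vectors with indices in `T`. -/
def coordPlane (T : Finset (Fin 11)) : Submodule ℝ Mink :=
  Submodule.span ℝ (Set.range fun i : T => e i)

theorem finrank_coordPlane (T : Finset (Fin 11)) : Module.finrank ℝ (coordPlane T) = T.card := by
  have h : LinearIndependent ℝ fun i : T => e i := by
    have := (Pi.basisFun ℝ (Fin 11)).linearIndependent.comp (fun i : T => (i : Fin 11))
      Subtype.val_injective
    convert this using 1
    ext i k
    simp [e]
  rw [coordPlane, finrank_span_eq_card h, Fintype.card_coe]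

theorem mem_coordPlane {T : Finset (Fin 11)} {x : Mink} :
    x ∈ coordPlane T ↔ ∀ k ∉ T, x k = 0 := by
  constructor
  · intro hx k hk
    have hle : coordPlane T ≤ LinearMap.ker (LinearMap.proj (R := ℝ) (φ := fun _ => ℝ) k) := by
      rw [coordPlane, Submodule.span_le]
      rintro _ ⟨i, rfl⟩
      have : k ≠ i := fun h => hk (h ▸ i.2)
      simp [e, this]
    exact hle hx
  · intro h
    have hx : x = ∑ i ∈ T, x i • e i := by
      ext k
      by_cases hk : k ∈ T <;> simp [e, Pi.single_apply, hk]
      exact h k hk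
    rw [hx]
    exact sum_mem fun i hi => Submodule.smul_mem _ _ (Submodule.subset_span ⟨⟨i, hi⟩, rfl⟩)

theorem spatialPlane_eq : spatialPlane = coordPlane {1, 3, 5, 7, 9} := by
  rw [spatialPlane, coordPlane]
  congr 1
  ext x
  simp [eq_comm]

theorem planeRot_mulVec (j k : Fin 11) (t : ℝ) (x : Mink) :
    (planeRot j k t).mulVec x = x + (Real.cos t - 1) • (x j • e j + x k • e k) +
      Real.sin t • (x k • e j - x j • e k) := by
  have hs (a b : Fin 11) : (Matrix.single a b (1 : ℝ)).mulVec x = x b • e a := by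
    rw [Matrix.single_mulVec]
    ext i
    simp [e, Function.update, Pi.single_apply]
  rw [planeRot, Matrix.add_mulVec, Matrix.add_mulVec, Matrix.smul_mulVec, Matrix.smul_mulVec,
    Matrix.add_mulVec, Matrix.sub_mulVec, Matrix.one_mulVec, hs, hs, hs, hs]

theorem torusRot_mulVec (θ : Fin 4 → ℝ) (x : Mink) :
    (torusRot θ).mulVec x =
      ![x 0, Real.cos (θ 0) * x 1 + Real.sin (θ 0) * x 2,
        Real.cos (θ 0) * x 2 - Real.sin (θ 0) * x 1,
        Real.cos (θ 1) * x 3 + Real.sin (θ 1) * x 4, Real.cos (θ 1) * x 4 - Real.sin (θ 1) * x 3,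
        Real.cos (θ 2) * x 5 + Real.sin (θ 2) * x 6, Real.cos (θ 2) * x 6 - Real.sin (θ 2) * x 5,
        Real.cos (θ 3) * x 7 + Real.sin (θ 3) * x 8, Real.cos (θ 3) * x 8 - Real.sin (θ 3) * x 7,
        x 9, x 10] := by
  rw [torusRot, ← Matrix.mulVec_mulVec, ← Matrix.mulVec_mulVec, ← Matrix.mulVec_mulVec,
    planeRot_mulVec, planeRot_mulVec, planeRot_mulVec, planeRot_mulVec]
  ext k
  fin_cases k <;> simp [e] <;> ring

open Classical in
/-- The indices of the frame vectors which span `ξ ∩ R(θ) ξ`. -/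
def commonIndices (θ : Fin 4 → ℝ) : Finset (Fin 11) :=
  insert 9 ((Finset.univ.filter fun i => Real.sin (θ i) = 0).image ![1, 3, 5, 7])

theorem mem_commonIndices {θ : Fin 4 → ℝ} {k : Fin 11} : k ∈ commonIndices θ ↔
    k = 9 ∨ (Real.sin (θ 0) = 0 ∧ k = 1) ∨ (Real.sin (θ 1) = 0 ∧ k = 3) ∨
      (Real.sin (θ 2) = 0 ∧ k = 5) ∨ (Real.sin (θ 3) = 0 ∧ k = 7) := by
  simp [commonIndices, Fin.exists_fin_succ, eq_comm]

theorem spatialPlane_inf_map (θ : Fin 4 → ℝ) :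
    spatialPlane ⊓ spatialPlane.map (Matrix.toLin' (torusRot θ)) =
      coordPlane (commonIndices θ) := by
  have hξ (x : Mink) : x ∈ spatialPlane ↔
      x 0 = 0 ∧ x 2 = 0 ∧ x 4 = 0 ∧ x 6 = 0 ∧ x 8 = 0 ∧ x 10 = 0 := by
    rw [spatialPlane_eq, mem_coordPlane]
    simp [Fin.forall_fin_succ]
  have hc (x : Mink) : x ∈ coordPlane (commonIndices θ) ↔
      (x 0 = 0 ∧ x 2 = 0 ∧ x 4 = 0 ∧ x 6 = 0 ∧ x 8 = 0 ∧ x 10 = 0) ∧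
      (Real.sin (θ 0) ≠ 0 → x 1 = 0) ∧ (Real.sin (θ 1) ≠ 0 → x 3 = 0) ∧
      (Real.sin (θ 2) ≠ 0 → x 5 = 0) ∧ (Real.sin (θ 3) ≠ 0 → x 7 = 0) := by
    rw [mem_coordPlane]
    simp only [mem_commonIndices, Fin.forall_fin_succ]
    simp
    tauto
  have hsin {t a : ℝ} (h : Real.sin t ≠ 0 → a = 0) : Real.sin t * (Real.cos t * a) = 0 := by
    by_cases hs : Real.sin t = 0
    · rw [hs, zero_mul]
    · rw [h hs]; ring
  have hcos {t a : ℝ} (h : Real.sin t ≠ 0 → a = 0) : Real.cos t * (Real.cos t * a) = a := by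
    by_cases hs : Real.sin t = 0
    · have := Real.sin_sq_add_cos_sq t
      rw [hs] at this
      linear_combination a * this
    · rw [h hs]; ring
  ext x
  rw [Submodule.mem_inf, Submodule.mem_map, hc]
  constructor
  · rintro ⟨hx, y, hy, rfl⟩
    refine ⟨(hξ _).1 hx, ?_⟩
    rw [hξ, Matrix.toLin'_apply, torusRot_mulVec] at hx
    rw [hξ] at hy
    rw [Matrix.toLin'_apply, torusRot_mulVec]
    obtain ⟨h0, h2, h4, h6, h8, h10⟩ := hy
    simp [h2, h4, h6, h8] at hx ⊢
    tauto
  · rintro ⟨⟨h0, h2, h4, h6, h8, h10⟩, h1, h3, h5, h7⟩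
    -- Where `x` has a nonzero coordinate in a rotated plane the sine vanishes, so the cosine is
    -- `±1` and its own inverse; this gives the preimage.
    refine ⟨(hξ x).2 ⟨h0, h2, h4, h6, h8, h10⟩, ![0, Real.cos (θ 0) * x 1, 0,
      Real.cos (θ 1) * x 3, 0, Real.cos (θ 2) * x 5, 0, Real.cos (θ 3) * x 7, 0, x 9, 0],
      (hξ _).2 (by simp), ?_⟩
    rw [Matrix.toLin'_apply, torusRot_mulVec]
    ext k
    fin_cases k <;>
      simp [h0, h2, h4, h6, h8, h10, hcos h1, hcos h3, hcos h5, hcos h7, -mul_eq_zero, hsin h1,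
        hsin h3, hsin h5, hsin h7]

open Classical in
theorem codim_eq (θ : Fin 4 → ℝ) :
    codim θ = (Finset.univ.filter fun i => Real.sin (θ i) ≠ 0).card := by
  have h9 : (9 : Fin 11) ∉
      (Finset.univ.filter fun i => Real.sin (θ i) = 0).image ![1, 3, 5, 7] := by
    simp [Fin.exists_fin_succ]
  have hinj : Function.Injective (![1, 3, 5, 7] : Fin 4 → Fin 11) := by decide
  have hcard := Finset.card_filter_add_card_filter_not (s := (Finset.univ : Finset (Fin 4)))
    (fun i => Real.sin (θ i) = 0)
  rw [codim, spatialPlane_inf_map, spatialPlane_eq, finrank_coordPlane, finrank_coordPlane,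
    commonIndices, Finset.card_insert_of_notMem h9, Finset.card_image_of_injective _ hinj]
  simp only [Finset.card_univ, Fintype.card_fin] at hcard
  have h5 : ({1, 3, 5, 7, 9} : Finset (Fin 11)).card = 5 := by decide
  rw [h5]
  simp only [ne_eq]
  omega

/-! ### Counting the fixed sectors -/

theorem sin_eq_zero_of_cos_eq_one {x : ℝ} (h : Real.cos x = 1) : Real.sin x = 0 := by
  have := Real.sin_sq_add_cos_sq x
  rw [h] at this
  nlinarith

theorem cos_sub_two_mul_eq_one_iff {x : ℝ} (h : Real.cos x = 1) (y : ℝ) :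
    Real.cos (x - 2 * y) = 1 ↔ Real.sin y = 0 := by
  rw [Real.cos_sub, h, sin_eq_zero_of_cos_eq_one h, Real.cos_two_mul, Real.cos_sq']
  constructor
  · intro h
    have : Real.sin y ^ 2 = 0 := by linarith
    simpa using this
  · intro h
    rw [h]; ring

theorem sin_add_eq_zero_iff {a : ℝ} (h : Real.sin a = 0) (b : ℝ) :
    Real.sin (a + b) = 0 ↔ Real.sin b = 0 := by
  have hc : Real.cos a ≠ 0 := by
    intro hc
    have := Real.sin_sq_add_cos_sq a
    rw [h, hc] at this
    norm_num at this
  rw [Real.sin_add, h, zero_mul, zero_add, mul_eq_zero, or_iff_right hc]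

theorem sin_sgn_mul_eq_zero_iff (b : Bool) (t : ℝ) : Real.sin (sgn b * t) = 0 ↔ Real.sin t = 0 := by
  cases b <;> simp [sgn]

/-- Change the signs of `s` at the places of `D`. -/
def flipSigns (s D : Bool × Bool × Bool) : Bool × Bool × Bool :=
  (xor s.1 D.1, xor s.2.1 D.2.1, xor s.2.2 D.2.2)

theorem flipSigns_bijective (s : Bool × Bool × Bool) : Function.Bijective (flipSigns s) := by
  revert s
  decide

/-- The part of the angle which changes its sign when `s` is flipped at the places of `D`. -/
def partialAngle (θ : Fin 4 → ℝ) (s D : Bool × Bool × Bool) : ℝ :=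
  (if D.1 then sgn s.1 * θ 1 else 0) + (if D.2.1 then sgn s.2.1 * θ 2 else 0) +
    (if D.2.2 then sgn s.2.2 * θ 3 else 0)

theorem sgn_xor (a b : Bool) : sgn (xor a b) = if b then -sgn a else sgn a := by
  cases a <;> cases b <;> simp [sgn]

theorem angle_flipSigns (θ : Fin 4 → ℝ) (s D : Bool × Bool × Bool) :
    angle θ (flipSigns s D) = angle θ s - 2 * partialAngle θ s D := by
  obtain ⟨D₁, D₂, D₃⟩ := D
  simp only [angle, flipSigns, partialAngle, sgn_xor]
  cases D₁ <;> cases D₂ <;> cases D₃ <;> simp <;> ring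

theorem flipSigns_mem_fixedSectors_iff {θ : Fin 4 → ℝ} {s : Bool × Bool × Bool}
    (hs : s ∈ fixedSectors θ) (D : Bool × Bool × Bool) :
    flipSigns s D ∈ fixedSectors θ ↔ Real.sin (partialAngle θ s D) = 0 := by
  rw [mem_fixedSectors] at hs ⊢
  rw [angle_flipSigns, cos_sub_two_mul_eq_one_iff hs]

/-- In a fixed sector the total angle is in `2πℤ`, so flipping all three signs is governed by `θ 0`
alone. -/
theorem sin_partialAngle_all {θ : Fin 4 → ℝ} {s : Bool × Bool × Bool}
    (hs : s ∈ fixedSectors θ) :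
    Real.sin (sgn s.1 * θ 1 + sgn s.2.1 * θ 2 + sgn s.2.2 * θ 3) = 0 ↔ Real.sin (θ 0) = 0 := by
  rw [mem_fixedSectors] at hs
  have h : sgn s.1 * θ 1 + sgn s.2.1 * θ 2 + sgn s.2.2 * θ 3 = angle θ s + -θ 0 := by
    rw [angle]; ring
  rw [h, sin_add_eq_zero_iff (sin_eq_zero_of_cos_eq_one hs), Real.sin_neg, neg_eq_zero]

open Classical in
/-- Whether the sine of `x` vanishes. -/
def sinZero (x : ℝ) : Bool := decide (Real.sin x = 0)

theorem sinZero_eq_true {x : ℝ} : sinZero x = true ↔ Real.sin x = 0 := by simp [sinZero]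

theorem sinZero_eq_false {x : ℝ} : sinZero x = false ↔ Real.sin x ≠ 0 := by simp [sinZero]

theorem sinZero_congr {x y : ℝ} (h : Real.sin x = 0 ↔ Real.sin y = 0) : sinZero x = sinZero y := by
  rw [Bool.eq_iff_iff, sinZero_eq_true, sinZero_eq_true, h]

theorem sinZero_sgn_mul (b : Bool) (t : ℝ) : sinZero (sgn b * t) = sinZero t :=
  sinZero_congr (sin_sgn_mul_eq_zero_iff b t)

/-- The eight sectors are the flips of `s`. No flip gives the 1, single flips give `θ 1, θ 2, θ 3`,
the triple flip gives `θ 0`, and the double flips give the sums of two signed angles. -/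
theorem card_fixedSectors {θ : Fin 4 → ℝ} {s : Bool × Bool × Bool} (hs : s ∈ fixedSectors θ) :
    (fixedSectors θ).card = 1 + (sinZero (θ 0)).toNat + (sinZero (θ 1)).toNat +
      (sinZero (θ 2)).toNat + (sinZero (θ 3)).toNat +
      (sinZero (sgn s.1 * θ 1 + sgn s.2.1 * θ 2)).toNat +
      (sinZero (sgn s.1 * θ 1 + sgn s.2.2 * θ 3)).toNat +
      (sinZero (sgn s.2.1 * θ 2 + sgn s.2.2 * θ 3)).toNat := by
  have h : (fixedSectors θ).card = ∑ D, (sinZero (partialAngle θ s D)).toNat := by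
    have h1 : (fixedSectors θ).card = ∑ t, if t ∈ fixedSectors θ then 1 else 0 := by simp
    rw [h1, ← (flipSigns_bijective s).sum_comp]
    refine Finset.sum_congr rfl fun D _ => ?_
    simp only [flipSigns_mem_fixedSectors_iff hs, ← sinZero_eq_true]
    cases sinZero (partialAngle θ s D) <;> rfl
  rw [h]
  simp only [Fintype.sum_prod_type, Fintype.sum_bool, partialAngle, if_true, Bool.false_eq_true,
    if_false, add_zero, zero_add, sinZero_congr (sin_partialAngle_all hs), sinZero_sgn_mul,
    sinZero_eq_true.2 Real.sin_zero, Bool.toNat_true]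
  ring

theorem codim_eq_sum (θ : Fin 4 → ℝ) :
    codim θ = (!sinZero (θ 0)).toNat + (!sinZero (θ 1)).toNat +
      (!sinZero (θ 2)).toNat + (!sinZero (θ 3)).toNat := by
  have h (x : ℝ) : (!sinZero x).toNat = if Real.sin x ≠ 0 then 1 else 0 := by
    by_cases hx : Real.sin x = 0
    · simp [sinZero_eq_true.2 hx, hx]
    · simp [sinZero_eq_false.2 hx, hx]
  rw [codim_eq, Finset.card_filter, Fin.sum_univ_four]
  simp only [h]

set_option synthInstance.maxSize 1000 in
set_option synthInstance.maxHeartbeats 200000 in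
/-- The pairs (codimension, number of fixed sectors), from the relations between the vanishing of
the sines of `q₀, …, q₃` and of sums of two of them. -/
theorem codim_card_cases : ∀ q₀ q₁ q₂ q₃ r₁₂ r₁₃ r₂₃ : Bool,
    (q₁ → r₁₂ = q₂) → (q₂ → r₁₂ = q₁) → (q₁ → r₁₃ = q₃) → (q₃ → r₁₃ = q₁) → (q₂ → r₂₃ = q₃) →
    (q₃ → r₂₃ = q₂) → (q₁ → r₂₃ = q₀) → (q₂ → r₁₃ = q₀) → (q₃ → r₁₂ = q₀) → (r₁₂ → q₀ = q₃) →
    (r₁₃ → q₀ = q₂) → (r₂₃ → q₀ = q₁) →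
    ((!q₀).toNat + (!q₁).toNat + (!q₂).toNat + (!q₃).toNat,
      1 + q₀.toNat + q₁.toNat + q₂.toNat + q₃.toNat + r₁₂.toNat + r₁₃.toNat + r₂₃.toNat) ∈
      [(4, 1), (4, 2), (4, 3), (4, 4), (3, 2), (2, 4), (0, 8)] := by
  decide

/-- With the signed angles `a`, `b`, `c`, the sum `a + b + c` stands for `θ 0`. If one of two
summands has vanishing sine, the other has it together with the sum; these relations leave only the
listed patterns. -/
theorem codim_card_mem {θ : Fin 4 → ℝ} (h : (fixedSectors θ).Nonempty) :
    (codim θ, (fixedSectors θ).card) ∈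
      [(4, 1), (4, 2), (4, 3), (4, 4), (3, 2), (2, 4), (0, 8)] := by
  obtain ⟨s, hs⟩ := h
  rw [codim_eq_sum, card_fixedSectors hs]
  rw [← sinZero_sgn_mul s.1 (θ 1), ← sinZero_sgn_mul s.2.1 (θ 2), ← sinZero_sgn_mul s.2.2 (θ 3),
    ← sinZero_congr (sin_partialAngle_all hs)]
  generalize sgn s.1 * θ 1 = a
  generalize sgn s.2.1 * θ 2 = b
  generalize sgn s.2.2 * θ 3 = c
  have hl (a b : ℝ) : sinZero a = true → sinZero (a + b) = sinZero b := fun h =>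
    sinZero_congr (sin_add_eq_zero_iff (sinZero_eq_true.1 h) b)
  have hr (a b : ℝ) : sinZero b = true → sinZero (a + b) = sinZero a := by
    rw [add_comm]; exact hl b a
  refine codim_card_cases _ _ _ _ _ _ _ (hl a b) (hr a b) (hl a c) (hr a c) (hl b c) (hr b c)
    (fun h => ?_) (fun h => ?_) (fun h => ?_) (hl (a + b) c) (fun h => ?_) (fun h => ?_)
  · rw [add_assoc]; exact (hl a (b + c) h).symm
  · rw [add_comm a b, add_assoc]; exact (hl b (a + c) h).symm
  · exact (hr (a + b) c h).symm
  · rw [add_right_comm]; exact hl (a + c) b h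
  · rw [add_assoc]; exact hr a (b + c) h

/-! ### Specialisation in codimension four -/

/-- The pairing of the sign vectors `(1, s)` and `(1, t)`. -/
def signPairing (s t : Bool × Bool × Bool) : ℝ :=
  1 + sgn t.1 * sgn s.1 + sgn t.2.1 * sgn s.2.1 + sgn t.2.2 * sgn s.2.2

theorem angle_add_smul (θ : Fin 4 → ℝ) (x : ℝ) (s t : Bool × Bool × Bool) :
    angle (θ + x • ![1, sgn s.1, sgn s.2.1, sgn s.2.2]) t = angle θ t + x * signPairing s t := by
  simp [angle, signPairing]
  ring

theorem signPairing_self (s : Bool × Bool × Bool) : signPairing s s = 4 := by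
  simp only [signPairing, sgn_mul_self]
  norm_num

/-- If no angle is a multiple of `π`, then distinct fixed sectors have orthogonal sign vectors. -/
theorem signPairing_eq_zero {θ : Fin 4 → ℝ} (hθ : ∀ i, Real.sin (θ i) ≠ 0)
    {s t : Bool × Bool × Bool} (hs : s ∈ fixedSectors θ) (ht : t ∈ fixedSectors θ) (hst : t ≠ s) :
    signPairing s t = 0 := by
  obtain ⟨D, rfl⟩ := (flipSigns_bijective s).surjective t
  rw [flipSigns_mem_fixedSectors_iff hs] at ht
  have h0 := sin_partialAngle_all hs
  have e1 := sin_sgn_mul_eq_zero_iff s.1 (θ 1)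
  have e2 := sin_sgn_mul_eq_zero_iff s.2.1 (θ 2)
  have e3 := sin_sgn_mul_eq_zero_iff s.2.2 (θ 3)
  obtain ⟨D₁, D₂, D₃⟩ := D
  simp only [signPairing, flipSigns, sgn_xor]
  -- One or three flips would make the sine of some angle vanish; two flips give `1 + 1 - 1 - 1 =
  -- 0`.
  cases D₁ <;> cases D₂ <;> cases D₃ <;>
    simp [partialAngle, flipSigns, h0, e1, e2, e3, hθ, sgn_mul_self] at ht hst ⊢

theorem codim_eq_four_iff {θ : Fin 4 → ℝ} : codim θ = 4 ↔ ∀ i, Real.sin (θ i) ≠ 0 := by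
  classical
  rw [codim_eq]
  have := Finset.card_filter_eq_iff (s := (Finset.univ : Finset (Fin 4)))
    (p := fun i => Real.sin (θ i) ≠ 0)
  simpa using this

/-- Move `θ` along the sign vector of a fixed sector `s`. The angle of `s` changes at rate 4, those
of the other fixed sectors do not change by orthogonality, and unfixed sectors and nonzero sines
persist nearby. So exactly `s` is lost. -/
theorem mem_closure_card {θ : Fin 4 → ℝ} {k : ℕ} (hd : codim θ = 4)
    (hk : (fixedSectors θ).card = k + 1) :
    θ ∈ closure {θ' : Fin 4 → ℝ | codim θ' = 4 ∧ (fixedSectors θ').card = k} := by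
  have hθ := codim_eq_four_iff.1 hd
  obtain ⟨s, hs⟩ : (fixedSectors θ).Nonempty := Finset.card_pos.1 (by omega)
  set path : ℝ → Fin 4 → ℝ := fun x => θ + x • ![1, sgn s.1, sgn s.2.1, sgn s.2.2] with hpath
  have hcont : Continuous path := by fun_prop
  have h0 : path 0 = θ := by simp only [hpath, zero_smul, add_zero]
  have htend : Filter.Tendsto path (nhds 0) (nhds θ) := by
    have := hcont.tendsto 0
    rwa [h0] at this
  have hsin : ∀ᶠ x in nhds (0 : ℝ), ∀ i, Real.sin (path x i) ≠ 0 := by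
    rw [Filter.eventually_all]
    intro i
    have hc : Continuous fun x => Real.sin (path x i) := by fun_prop
    exact hc.continuousAt.eventually_ne (by rw [h0]; exact hθ i)
  have hcos : ∀ᶠ x in nhds (0 : ℝ), ∀ t, t ∉ fixedSectors θ → t ∉ fixedSectors (path x) := by
    rw [Filter.eventually_all]
    intro t
    by_cases ht : t ∈ fixedSectors θ
    · exact Filter.Eventually.of_forall fun x h => absurd ht h
    · have hc : Continuous fun x => Real.cos (angle θ t + x * signPairing s t) := by fun_prop
      filter_upwards [hc.continuousAt.eventually_ne (y := 1) (x := 0)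
        (by simpa [mem_fixedSectors] using ht)] with x hx _
      rwa [mem_fixedSectors, hpath, angle_add_smul]
  -- The bound keeps the change `4 x` of the angle of `s` inside `(-2π, 2π)`, where only `x = 0`
  -- gives cosine 1.
  have hsmall : ∀ᶠ x in nhdsWithin (0 : ℝ) {0}ᶜ, x ≠ 0 ∧ |x| < 1 := by
    refine Filter.Eventually.and self_mem_nhdsWithin (nhdsWithin_le_nhds ?_)
    have hc : Continuous fun x : ℝ => |x| := continuous_abs
    exact hc.continuousAt.eventually_lt continuousAt_const (by simp)
  refine mem_closure_of_tendsto (htend.mono_left (nhdsWithin_le_nhds (s := {0}ᶜ))) ?_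
  filter_upwards [nhdsWithin_le_nhds hsin, nhdsWithin_le_nhds hcos, hsmall] with x h1 h2 h3
  refine ⟨codim_eq_four_iff.2 h1, ?_⟩
  have hF : fixedSectors (path x) = (fixedSectors θ).erase s := by
    ext t
    rw [Finset.mem_erase]
    by_cases ht : t ∈ fixedSectors θ
    · by_cases hts : t = s
      · subst hts
        simp only [ne_eq, not_true_eq_false, false_and, iff_false]
        rw [mem_fixedSectors] at ht ⊢
        rw [hpath, angle_add_smul, signPairing_self, Real.cos_add, ht,
          sin_eq_zero_of_cos_eq_one ht, one_mul, zero_mul, sub_zero,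
          Real.cos_eq_one_iff_of_lt_of_lt]
        · simpa using h3.1
        · have := (abs_lt.1 h3.2).1
          linarith [Real.pi_gt_three]
        · have := (abs_lt.1 h3.2).2
          linarith [Real.pi_gt_three]
      · simp only [ne_eq, hts, not_false_eq_true, ht, and_self, iff_true]
        rw [mem_fixedSectors] at ht ⊢
        rw [hpath, angle_add_smul, signPairing_eq_zero hθ hs (mem_fixedSectors.2 ht) hts, mul_zero,
          add_zero, ht]
    · simp [ht, h2 t ht]
  rw [hF, Finset.card_erase_of_mem hs, hk, Nat.add_sub_cancel]

/-! ### Examples of angles -/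

/-- With total angle zero the sector of positive signs is fixed, so `card_fixedSectors` applies with
no signs left. -/
theorem codim_card_of_sum_zero (a b c : ℝ) :
    codim ![-(a + b + c), a, b, c] = (!sinZero (a + b + c)).toNat + (!sinZero a).toNat +
      (!sinZero b).toNat + (!sinZero c).toNat ∧
    (fixedSectors ![-(a + b + c), a, b, c]).card =
      1 + (sinZero (a + b + c)).toNat + (sinZero a).toNat + (sinZero b).toNat +
      (sinZero c).toNat + (sinZero (a + b)).toNat + (sinZero (a + c)).toNat +
      (sinZero (b + c)).toNat := by
  have hs : (true, true, true) ∈ fixedSectors ![-(a + b + c), a, b, c] := by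
    have h0 : angle ![-(a + b + c), a, b, c] (true, true, true) = 0 := by
      simp [angle, sgn]
      ring
    rw [mem_fixedSectors, h0, Real.cos_zero]
  have hneg : sinZero (-(a + b + c)) = sinZero (a + b + c) :=
    sinZero_congr (by rw [Real.sin_neg, neg_eq_zero])
  rw [codim_eq_sum, card_fixedSectors hs]
  simp only [sgn, if_true, one_mul, Matrix.cons_val, hneg, and_self]

theorem exists_codim_card {p : ℕ × ℕ}
    (hp : p ∈ [(4, 1), (4, 2), (4, 3), (4, 4), (3, 2), (2, 4), (0, 8)]) :
    ∃ θ : Fin 4 → ℝ, codim θ = p.1 ∧ (fixedSectors θ).card = p.2 := by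
  have hpos {x : ℝ} (h1 : 0 < x) (h2 : x < 3) : sinZero x = false :=
    sinZero_eq_false.2 (Real.sin_pos_of_pos_of_lt_pi h1 (h2.trans Real.pi_gt_three)).ne'
  have hneg (x : ℝ) : sinZero (-x) = sinZero x :=
    sinZero_congr (by rw [Real.sin_neg, neg_eq_zero])
  have h0 : sinZero 0 = true := sinZero_eq_true.2 Real.sin_zero
  have hhalf : sinZero (1 / 2) = false := hpos (by norm_num) (by norm_num)
  have hone : sinZero 1 = false := hpos (by norm_num) (by norm_num)
  have htwo : sinZero 2 = false := hpos (by norm_num) (by norm_num)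
  have h32 : sinZero (3 / 2) = false := hpos (by norm_num) (by norm_num)
  have hpi : sinZero Real.pi = true := sinZero_eq_true.2 Real.sin_pi
  have hpi2 : sinZero (Real.pi / 2) = false := sinZero_eq_false.2 (by simp)
  have key (a b c ab ac bc abc : ℝ) (e1 : a + b = ab) (e2 : a + c = ac) (e3 : b + c = bc)
      (e4 : a + b + c = abc) (hd : (!sinZero abc).toNat + (!sinZero a).toNat +
        (!sinZero b).toNat + (!sinZero c).toNat = p.1)
      (hn : 1 + (sinZero abc).toNat + (sinZero a).toNat + (sinZero b).toNat +
        (sinZero c).toNat + (sinZero ab).toNat + (sinZero ac).toNat + (sinZero bc).toNat = p.2) :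
      ∃ θ : Fin 4 → ℝ, codim θ = p.1 ∧ (fixedSectors θ).card = p.2 := by
    subst e1 e2 e3 e4
    rw [← hd, ← hn]
    exact ⟨_, codim_card_of_sum_zero a b c⟩
  simp only [List.mem_cons, List.not_mem_nil, or_false] at hp
  rcases hp with rfl | rfl | rfl | rfl | rfl | rfl | rfl
  -- In order: no coincidence; `a + b = 0`; also `a + c = 0`; also `b + c = -π`; then one, two and
  -- three of `a`, `b`, `c` equal to zero.
  · exact key (1 / 2) (1 / 2) (1 / 2) 1 1 1 (3 / 2) (by norm_num) (by norm_num) (by norm_num)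
      (by norm_num) (by simp only [hhalf, h32]; rfl) (by simp only [hhalf, hone, h32]; rfl)
  · exact key 1 (-1) (1 / 2) 0 (3 / 2) (-(1 / 2)) (1 / 2) (by norm_num) (by norm_num) (by norm_num)
      (by norm_num) (by simp only [hneg, hhalf, hone]; rfl)
      (by simp only [hneg, h0, hhalf, hone, h32]; rfl)
  · exact key 1 (-1) (-1) 0 0 (-2) (-1) (by norm_num) (by norm_num) (by norm_num)
      (by norm_num) (by simp only [hneg, hone]; rfl) (by simp only [hneg, h0, hone, htwo]; rfl)
  · exact key (Real.pi / 2) (-(Real.pi / 2)) (-(Real.pi / 2)) 0 0 (-Real.pi) (-(Real.pi / 2))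
      (by ring) (by ring) (by ring) (by ring) (by simp only [hneg, hpi2]; rfl) (by simp only [hneg, h0, hpi, hpi2]; rfl)
  · exact key 0 (1 / 2) (1 / 2) (1 / 2) (1 / 2) 1 1 (by norm_num) (by norm_num) (by norm_num)
      (by norm_num) (by simp only [h0, hhalf, hone]; rfl) (by simp only [h0, hhalf, hone]; rfl)
  · exact key 0 0 1 0 1 1 1 (by norm_num) (by norm_num) (by norm_num)
      (by norm_num) (by simp only [h0, hone]; rfl) (by simp only [h0, hone]; rfl)
  · exact key 0 0 0 0 0 0 0 (by norm_num) (by norm_num) (by norm_num)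
      (by norm_num) (by simp only [h0]; rfl) (by simp only [h0]; rfl)

/-! ### The table of null rotations -/

section Table

variable {Δ : Type*} [AddCommGroup Δ] [Module ℝ Δ] [Module Cl Δ] [IsScalarTower ℝ Cl Δ]
  [IsSimpleModule Cl Δ] {α β : ℝ}

theorem fraction_null (θ : Fin 4 → ℝ) (h : α ^ 2 = β ^ 2) (hα : α ≠ 0) :
    fraction Δ brane (transform (lorentzL θ α β) brane) = ((fixedSectors θ).card : ℚ) / 32 := by
  rw [fraction, finrank_null θ h hα]

theorem fraction_null_eq_iff (θ : Fin 4 → ℝ) (h : α ^ 2 = β ^ 2) (hα : α ≠ 0) (n : ℕ) :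
    fraction Δ brane (transform (lorentzL θ α β) brane) = (n : ℚ) / 32 ↔
      (fixedSectors θ).card = n := by
  rw [fraction_null θ h hα, div_left_inj' (by norm_num), Nat.cast_inj]

theorem isSupersymmetric_null_iff (θ : Fin 4 → ℝ) (h : α ^ 2 = β ^ 2) (hα : α ≠ 0) :
    IsSupersymmetric Δ brane (transform (lorentzL θ α β) brane) ↔ (fixedSectors θ).Nonempty := by
  obtain ⟨_, -⟩ := finrank_le_thirtytwo Δ
  rw [IsSupersymmetric, ← Finset.card_pos, ← finrank_null (Δ := Δ) θ h hα, Nat.pos_iff_ne_zero,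
    Ne, Ne, Submodule.finrank_eq_zero]

theorem mem_nullTable_iff (p : ℕ × ℚ) : p ∈ nullTable ↔ ∃ q : ℕ × ℕ,
    q ∈ [(4, 1), (4, 2), (4, 3), (4, 4), (3, 2), (2, 4), (0, 8)] ∧ p = (q.1, (q.2 : ℚ) / 32) := by
  simp only [nullTable, List.mem_cons, List.not_mem_nil, or_false, Set.mem_insert_iff,
    Set.mem_singleton_iff, or_and_right, exists_or, exists_eq_left]
  norm_num

variable (Δ) in
theorem null_pairs_eq (h : α ^ 2 = β ^ 2) (hα : α ≠ 0) :
    {p : ℕ × ℚ | ∃ θ : Fin 4 → ℝ,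
        IsSupersymmetric Δ brane (transform (lorentzL θ α β) brane) ∧
        codim θ = p.1 ∧ fraction Δ brane (transform (lorentzL θ α β) brane) = p.2} =
      nullTable := by
  ext ⟨d, ν⟩
  rw [Set.mem_ofPred_eq, mem_nullTable_iff]
  constructor
  · rintro ⟨θ, h1, rfl, rfl⟩
    rw [isSupersymmetric_null_iff θ h hα] at h1
    exact ⟨_, codim_card_mem h1, by rw [fraction_null θ h hα]⟩
  · rintro ⟨q, hq, h2⟩
    obtain ⟨rfl, rfl⟩ := Prod.mk.inj h2
    obtain ⟨θ, hd, hn⟩ := exists_codim_card hq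
    refine ⟨θ, ?_, hd, (fraction_null_eq_iff θ h hα _).2 hn⟩
    rw [isSupersymmetric_null_iff θ h hα, ← Finset.card_pos, hn]
    clear hn hd h2
    revert q
    decide

variable (Δ) in
theorem null_specialisation (h : α ^ 2 = β ^ 2) (hα : α ≠ 0) (k : ℕ) :
    {θ : Fin 4 → ℝ | codim θ = 4 ∧
        fraction Δ brane (transform (lorentzL θ α β) brane) = ((k : ℚ) + 1) / 32} ⊆
      closure {θ : Fin 4 → ℝ | codim θ = 4 ∧
        fraction Δ brane (transform (lorentzL θ α β) brane) = (k : ℚ) / 32} := by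
  rintro θ ⟨hd, hn⟩
  simp only [fraction_null_eq_iff _ h hα]
  rw [← Nat.cast_succ, fraction_null_eq_iff θ h hα] at hn
  exact mem_closure_card hd hn

end Table

end M5

end

/-! ### The main theorem -/

open M5 in
theorem mainTheorem1 (Δ : Type*) [AddCommGroup Δ] [Module ℝ Δ] [Module Cl Δ]
    [IsScalarTower ℝ Cl Δ] [IsSimpleModule Cl Δ] :
    -- the spinor representation has dimension 32
    Module.finrank ℝ Δ = 32 ∧
    -- `R̂` is a lift of the rotation, and `1 + N̂/2` is a lift of the null rotation
    (∀ θ : Fin 4 → ℝ, IsSpinLift (Rhat θ) (torusRot θ)) ∧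
    (∀ α β : ℝ, α ^ 2 = β ^ 2 →
      IsSpinLift (1 + (1 / 2 : ℝ) • Nhat α β) (lorentzS α β)) ∧
    -- nontrivial boosts break all supersymmetry
    (∀ (θ : Fin 4 → ℝ) (α β : ℝ), β ^ 2 < α ^ 2 →
      ¬ IsSupersymmetric Δ brane (transform (lorentzL θ α β) brane)) ∧
    -- the conditions for static branes
    (∀ (θ : Fin 4 → ℝ) (ε : Δ),
      ε ∈ susySpace₂ Δ brane (transform (torusRot θ) brane) ↔
        quantize brane • ε = ε ∧ Rhat θ ^ 2 • ε = ε) ∧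
    -- the conditions for null-rotated branes
    (∀ (θ : Fin 4 → ℝ) (α β : ℝ), α ^ 2 = β ^ 2 → ∀ ε : Δ,
      ε ∈ susySpace₂ Δ brane (transform (lorentzL θ α β) brane) ↔
        quantize brane • ε = ε ∧ Rhat θ ^ 2 • ε = ε ∧ Nhat α β • ε = 0) ∧
    (∀ α β : ℝ, α ^ 2 = β ^ 2 → α ≠ 0 →
      -- exactly half of the static solutions survive
      (∀ θ : Fin 4 → ℝ,
        2 * Module.finrank ℝ (susySpace₂ Δ brane (transform (lorentzL θ α β) brane)) =
          Module.finrank ℝ (susySpace₂ Δ brane (transform (torusRot θ) brane))) ∧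
      -- the pairs (codimension, fraction) which occur are those of the table
      {p : ℕ × ℚ | ∃ θ : Fin 4 → ℝ,
        IsSupersymmetric Δ brane (transform (lorentzL θ α β) brane) ∧
        codim θ = p.1 ∧ fraction Δ brane (transform (lorentzL θ α β) brane) = p.2} = nullTable ∧
      -- in codimension 4 the fractions 1/32 → 1/16 → 3/32 → 1/8 arise by progressive specialisation
      (∀ k : ℕ, 1 ≤ k → k ≤ 3 →
        {θ : Fin 4 → ℝ | codim θ = 4 ∧
          fraction Δ brane (transform (lorentzL θ α β) brane) = ((k : ℚ) + 1) / 32} ⊆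
        closure {θ : Fin 4 → ℝ | codim θ = 4 ∧
          fraction Δ brane (transform (lorentzL θ α β) brane) = (k : ℚ) / 32})) := by
  exact ⟨finrank_spinors Δ, Rhat_isSpinLift, fun α β h => one_add_Nhat_isSpinLift h,
    fun θ α β h => not_not.2 (susySpace₂_boost_eq_bot θ h), mem_susySpace₂_static,
    fun θ α β h => mem_susySpace₂_null θ h, fun α β h hα =>
      ⟨fun θ => two_mul_finrank_null θ h hα, null_pairs_eq Δ h hα,
        fun k _ _ => null_specialisation Δ h hα k⟩⟩
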